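/- Let $\mathbf{Glob}$ be the category of globular sets ($X=(X_n)_{n\ge 0}$ with $\mathrm{src},\mathrm{tgt}:X_{n+1}\to X_n$, $\mathrm{src}\,\mathrm{src}=\mathrm{src}\,\mathrm{tgt}$, $\mathrm{tgt}\,\mathrm{src}=\mathrm{tgt}\,\mathrm{tgt}$). *Batanin trees.* Batanin trees are generated inductively by $\mathrm{br}[B_1,\dots,B_m]$, $m\ge 0$; $\dim B$ is the height of $B$, and $\mathrm{Pos}(B)$ is the globular set of positions (the pasting diagram) of $B$. An $n$-position of $B$ is *source boundary* (resp. *target boundary*) if it is not the target (resp. source) of any $(n+1)$-position; write $\partial^s_nB$ and $\partial^t_nB$ for the sets of those. *Computads.* By induction on $n$ one defines the category $\mathbf{Comp}_n$ of $n$-computads, functors $\mathrm{Cell}_n,\mathrm{Sph}_n:\mathbf{Comp}_n\to\mathbf{Set}$ of cells and spheres, $\mathrm{Free}_n:\mathbf{Glob}\to\mathbf{Comp}_n$, and the full $n$-spheres of $\mathrm{Free}_n\mathrm{Pos}(B)$. For $n=0$: $\mathbf{Comp}_0=\mathbf{Set}$, $\mathrm{Cell}_0(C)=C$, $\mathrm{Sph}_0(C)=C\times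 C$, $\mathrm{Free}_0X=X_0$; a $0$-sphere $(a,b)$ of $B$ is full if $a\in\partial^s_0B$ and $b\in\partial^t_0B$. For $n>0$: - An $n$-computad is a triple $C=(C_{n-1},V_n,\phi_n:V_n\to\mathrm{Sph}_{n-1}(C_{n-1}))$ with $C_{n-1}$ an $(n-1)$-computad and $V_n$ a set of generators. - The cells in $\mathrm{Cell}_n(C)$, with their boundary $\mathrm{ty}$ in $\mathrm{Sph}_{n-1}(C_{n-1})$, are generated inductively by $\mathrm{var}\,v$ for $v\in V_n$, with boundary $\phi_n(v)$, and $\mathrm{coh}(B,A,\tau)$, with boundary $\mathrm{Sph}_{n-1}(\tau_{n-1})(A)$, where $\dim B\le n$, $A$ is a full $(n-1)$-sphere of $B$, and $\tau:\mathrm{Free}_n\mathrm{Pos}(B)\to C$ is a homomorphism. - A homomorphism $\sigma:D\to C$ is a pair of a homomorphism $\sigma_{n-1}:D_{n-1}\to C_{n-1}$ and a function $\sigma_V:V_n^D\to\mathrm{Cell}_n(C)$ compatible with boundaries. It acts on cells by $\mathrm{var}\,v\mapsto\sigma_V(v)$ and $\mathrm{coh}(B,A,\tau)\mapsto\mathrm{coh}(B,A,\sigma\circ\tau)$.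 - An $n$-sphere is a triple $(A,a,b)$ with $\mathrm{ty}(a)=\mathrm{ty}(b)=A$. - $\mathrm{Free}_nX$ consists of $\mathrm{Free}_{n-1}X$ together with the generators $X_n$, the boundary of $x$ being the sphere of generators given by $\mathrm{src}\,x$, $\mathrm{tgt}\,x$ and their iterated sources and targets. - The support of a cell is the set of $n$-dimensional generators occurring in it. The sphere $(A,a,b)$ of $B$ is full if $a$ has support $\partial^s_nB$, $b$ has support $\partial^t_nB$, and $A$ is full. Let $\mathbf{Comp}$ be the limit of the categories $\mathbf{Comp}_n$ along the forgetful functors. The functor $\mathrm{Cell}:\mathbf{Comp}\to\mathbf{Glob}$, sending a computad to its globular set of cells, has as left adjoint the functor $\mathrm{Free}$. Let $\mathrm{fc}^w=\mathrm{Cell}\circ\mathrm{Free}$ be the monad on $\mathbf{Glob}$ induced by this adjunction (the free weak $\omega$-category monad), and let $\omega\mathbf{Cat}$ be its category of algebras. **Statement.** The monad $\mathrm{fc}^w$ is finitary: its underlying endofunctor $\mathbf{Glob}\to\mathbf{Glob}$ preserves small filtered (in particular, directed) colimits. Moreover, the category $\omega\mathbf{Cat}$ is locally finitely presentable. -/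

import Mathlib

open CategoryTheory

universe u

namespace WeakOmega

/-! ### Globular sets -/

/-- A globular set: sets of `n`-cells with source and target maps satisfying globularity. -/
structure Glob : Type (u + 1) where
  cell : ℕ → Type u
  src : ∀ {n : ℕ}, cell (n + 1) → cell n
  tgt : ∀ {n : ℕ}, cell (n + 1) → cell n
  src_src : ∀ {n : ℕ} (x : cell (n + 2)), src (src x) = src (tgt x)
  tgt_src : ∀ {n : ℕ} (x : cell (n + 2)), tgt (src x) = tgt (tgt x)

namespace Glob

/-- Morphisms of globular sets. -/
@[ext]
structure Hom (X Y : Glob.{u}) : Type u where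
  app : ∀ n : ℕ, X.cell n → Y.cell n
  src_app : ∀ {n : ℕ} (x : X.cell (n + 1)), Y.src (app (n + 1) x) = app n (X.src x)
  tgt_app : ∀ {n : ℕ} (x : X.cell (n + 1)), Y.tgt (app (n + 1) x) = app n (X.tgt x)

instance : Category.{u} Glob.{u} where
  Hom X Y := Hom X Y
  id X := ⟨fun _ x => x, fun _ => rfl, fun _ => rfl⟩
  comp f g :=
    { app := fun n x => g.app n (f.app n x)
      src_app := fun x => by rw [g.src_app, f.src_app]
      tgt_app := fun x => by rw [g.tgt_app, f.tgt_app] }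

@[ext]
theorem hom_ext {X Y : Glob.{u}} {f g : X ⟶ Y} (h : ∀ n x, f.app n x = g.app n x) : f = g :=
  Hom.ext (funext fun n => funext fun x => h n x)

/-- Two `n`-cells are parallel when they have common source and target; any two `0`-cells are. -/
def Parallel (X : Glob.{u}) : ∀ {n : ℕ}, X.cell n → X.cell n → Prop
  | 0, _, _ => True
  | _ + 1, a, b => X.src a = X.src b ∧ X.tgt a = X.tgt b

theorem parallel_src_tgt (X : Glob.{u}) : ∀ {n : ℕ} (x : X.cell (n + 1)),
    X.Parallel (X.src x) (X.tgt x)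
  | 0, _ => trivial
  | _ + 1, x => ⟨X.src_src x, X.tgt_src x⟩

theorem Parallel.map {X Y : Glob.{u}} (f : X ⟶ Y) : ∀ {n : ℕ} {a b : X.cell n},
    X.Parallel a b → Y.Parallel (f.app n a) (f.app n b)
  | 0, _, _, _ => trivial
  | n + 1, a, b, h => by
      refine ⟨?_, ?_⟩
      · rw [f.src_app, f.src_app, h.1]
      · rw [f.tgt_app, f.tgt_app, h.2]

end Glob

/-! ### Batanin trees and their positions -/

/-- Batanin trees: `br [B₁, …, Bₙ]` for every list of Batanin trees. -/
inductive Bat : Type where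
  | br : List Bat → Bat

mutual
/-- The dimension (height) of a Batanin tree. -/
def Bat.dim : Bat → ℕ
  | .br L => Bat.dimList L
/-- The dimension of `br L`. -/
def Bat.dimList : List Bat → ℕ
  | [] => 0
  | B :: L => max (Bat.dim B + 1) (Bat.dimList L)
end

/-- `Pos B n` is the set of positions of dimension `n` of the Batanin tree `B`. -/
inductive Pos : Bat → ℕ → Type u where
  | here (B : Bat) : Pos B 0
  | inr {B : Bat} {L : List Bat} {n : ℕ} (p : Pos (.br L) n) : Pos (.br (B :: L)) n
  | inl {B : Bat} {L : List Bat} {n : ℕ} (q : Pos B n) : Pos (.br (B :: L)) (n + 1)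

namespace Pos

/-- The source of a position. It is used in positive dimension only; the value on the position
`here` is a convention that makes the recursion total. -/
def src : ∀ {B : Bat} {n : ℕ}, Pos.{u} B n → Pos.{u} B (n - 1)
  | _, _, .here B => .here B
  | _, _, .inr p => .inr p.src
  | _, 1, .inl _ => .here _
  | _, _ + 2, .inl q => .inl q.src

/-- The target of a position. It is used in positive dimension only; the value on the position
`here` is a convention that makes the recursion total. -/
def tgt : ∀ {B : Bat} {n : ℕ}, Pos.{u} B n → Pos.{u} B (n - 1)
  | _, _, .here B => .here B
  | _, _, .inr p => .inr p.tgt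
  | _, 1, .inl _ => .inr (.here _)
  | _, _ + 2, .inl q => .inl q.tgt

theorem src_src : ∀ {B : Bat} {n : ℕ} (p : Pos.{u} B n), 2 ≤ n → p.src.src = p.tgt.src
  | _, _, .here _, h => absurd h (by decide)
  | _, _, .inr p, h => congrArg Pos.inr (src_src p h)
  | _, 1, .inl _, h => absurd h (by decide)
  | _, 2, .inl _, _ => rfl
  | _, _ + 3, .inl q, _ => congrArg Pos.inl (src_src q (by omega))

theorem tgt_src : ∀ {B : Bat} {n : ℕ} (p : Pos.{u} B n), 2 ≤ n → p.src.tgt = p.tgt.tgt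
  | _, _, .here _, h => absurd h (by decide)
  | _, _, .inr p, h => congrArg Pos.inr (tgt_src p h)
  | _, 1, .inl _, h => absurd h (by decide)
  | _, 2, .inl _, _ => rfl
  | _, _ + 3, .inl q, _ => congrArg Pos.inl (tgt_src q (by omega))

end Pos

namespace Bat

/-- The globular set of positions of a Batanin tree. -/
def pos (B : Bat) : Glob.{u} where
  cell n := Pos.{u} B n
  src {n} p := (Pos.src p : Pos B (n + 1 - 1))
  tgt {n} p := (Pos.tgt p : Pos B (n + 1 - 1))
  src_src p := Pos.src_src p (by omega)
  tgt_src p := Pos.tgt_src p (by omega)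

/-- The source boundary `n`-positions: those that are not the target of a position. -/
def srcBoundary (B : Bat) (n : ℕ) : Set (B.pos.{u}.cell n) :=
  {p | ¬ ∃ q : B.pos.{u}.cell (n + 1), B.pos.tgt q = p}

/-- The target boundary `n`-positions: those that are not the source of a position. -/
def tgtBoundary (B : Bat) (n : ℕ) : Set (B.pos.{u}.cell n) :=
  {p | ¬ ∃ q : B.pos.{u}.cell (n + 1), B.pos.src q = p}

end Bat

theorem map_id_apply {C : Type*} [Category* C] (F : C ⥤ Type u) (X : C) (x : F.obj X) :
    F.map (𝟙 X) x = x := by simp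

theorem map_comp_apply {C : Type*} [Category* C] (F : C ⥤ Type u) {X Y Z : C} (f : X ⟶ Y)
    (g : Y ⟶ Z) (x : F.obj X) : F.map (f ≫ g) x = F.map g (F.map f x) := by simp

theorem app_map_apply {C : Type*} [Category* C] {F G : C ⥤ Type u} (α : F ⟶ G) {X Y : C}
    (f : X ⟶ Y) (x : F.obj X) : α.app Y (F.map f x) = G.map f (α.app X x) :=
  NatTrans.naturality_apply α f x

/-! ### Computads of finite dimension

`Stage n` is the type of the data carried by the induction on the dimension `n` that
defines `n`-computads. Stages are never quantified over: the stages of interest are those of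
the sequence `stage` built below, starting from `Stage.zero` and iterating `Stage.succ`. -/

/-- The data available at dimension `n`: the category `Comp` of `n`-computads, the functors of
`n`-cells and of `n`-spheres with the two projections, the functor `Free` from globular sets,
the inclusion `gen` of the `n`-cells of `X` as generator cells of `Free X`, the `n`-sphere
`posSph` of `Free X` given by a pair of parallel `n`-cells of `X`, and the set of full
`n`-spheres of every Batanin tree. -/
structure Stage (n : ℕ) : Type (u + 2) where
  Comp : Type (u + 1)
  [cat : Category.{u} Comp]
  Cell : Comp ⥤ Type u
  Sph : Comp ⥤ Type u
  fst : Sph ⟶ Cell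
  snd : Sph ⟶ Cell
  sph_ext : ∀ {C : Comp} (A A' : Sph.obj C),
    fst.app C A = fst.app C A' → snd.app C A = snd.app C A' → A = A'
  Free : Glob.{u} ⥤ Comp
  gen : ∀ (X : Glob.{u}), X.cell n → Cell.obj (Free.obj X)
  gen_map : ∀ {X Y : Glob.{u}} (f : X ⟶ Y) (x : X.cell n),
    Cell.map (Free.map f) (gen X x) = gen Y (f.app n x)
  posSph : ∀ (X : Glob.{u}) (a b : X.cell n), X.Parallel a b → Sph.obj (Free.obj X)
  fst_posSph : ∀ (X : Glob.{u}) (a b : X.cell n) (h : X.Parallel a b),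
    fst.app _ (posSph X a b h) = gen X a
  snd_posSph : ∀ (X : Glob.{u}) (a b : X.cell n) (h : X.Parallel a b),
    snd.app _ (posSph X a b h) = gen X b
  Full : ∀ B : Bat, Set (Sph.obj (Free.obj B.pos))

attribute [instance] Stage.cat

namespace Stage

/-- Dimension `0`: a `0`-computad is a set, its cells are its elements, and its spheres are
pairs of elements. A `0`-sphere `(a, b)` of a tree is full when `a` is source boundary and `b`
is target boundary. -/
def zero : Stage.{u} 0 where
  Comp := Type u
  Cell := 𝟭 (Type u)
  Sph :=
    { obj := fun C => C × C
      map := fun σ => ↾(fun A => (σ A.1, σ A.2)) }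
  fst := { app := fun _ => ↾(fun A => A.1) }
  snd := { app := fun _ => ↾(fun A => A.2) }
  sph_ext := fun _ _ h h' => Prod.ext h h'
  Free :=
    { obj := fun X => X.cell 0
      map := fun f => ↾(f.app 0) }
  gen := fun _ x => x
  gen_map := fun _ _ => rfl
  posSph := fun _ a b _ => (a, b)
  fst_posSph := fun _ _ _ _ => rfl
  snd_posSph := fun _ _ _ _ => rfl
  Full := fun B => {A | A.1 ∈ B.srcBoundary 0 ∧ A.2 ∈ B.tgtBoundary 0}

section Succ

variable {n : ℕ} (S : Stage.{u} n)

theorem sph_map_posSph {X Y : Glob.{u}} (f : X ⟶ Y) (a b : X.cell n) (h : X.Parallel a b) :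
    S.Sph.map (S.Free.map f) (S.posSph X a b h) =
      S.posSph Y (f.app n a) (f.app n b) (h.map f) := by
  apply S.sph_ext
  · rw [NatTrans.naturality_apply, S.fst_posSph, S.fst_posSph, S.gen_map]
  · rw [NatTrans.naturality_apply, S.snd_posSph, S.snd_posSph, S.gen_map]

/-- The boundary `n`-sphere in `Free X` of an `(n + 1)`-cell of the globular set `X`. -/
def freeBdry (X : Glob.{u}) (x : X.cell (n + 1)) : S.Sph.obj (S.Free.obj X) :=
  S.posSph X (X.src x) (X.tgt x) (X.parallel_src_tgt x)

/-- An `(n + 1)`-computad: an `n`-computad, a set of generators of dimension `n + 1`, and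
a boundary `n`-sphere for each of those generators. -/
structure Computad : Type (u + 1) where
  base : S.Comp
  Gen : Type u
  bdry : Gen → S.Sph.obj base

variable {S}

/-- Formal `(n + 1)`-cells of `C`: generators, and triples `coh B A τ` where `B` is a tree of
dimension at most `n + 1`, `A` is a full `n`-sphere of `B`, and `τ` consists of a homomorphism
`Free B ⟶ C` in dimensions at most `n` and a formal `(n + 1)`-cell of `C` for every
`(n + 1)`-position of `B`. The compatibility of `τ` with boundaries is `PreCell.WF`. -/
inductive PreCell (C : Computad S) : Type u where
  | var (v : C.Gen) : PreCell C
  | coh (B : Bat) (hB : B.dim ≤ n + 1) (A : S.Sph.obj (S.Free.obj B.pos)) (hA : A ∈ S.Full B)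
      (τ : S.Free.obj B.pos ⟶ C.base) (τV : B.pos.{u}.cell (n + 1) → PreCell C) : PreCell C

namespace PreCell

variable {C : Computad S}

/-- The boundary sphere of a formal cell. -/
def ty : PreCell C → S.Sph.obj C.base
  | .var v => C.bdry v
  | .coh _ _ A _ τ _ => S.Sph.map τ A

/-- A formal cell is a cell when, hereditarily, in every `coh B A τ` the assignment `τ` is
compatible with boundaries, i.e. is an `(n + 1)`-homomorphism `Free B ⟶ C`. -/
def WF : PreCell C → Prop
  | .var _ => True
  | .coh B _ _ _ τ τV => ∀ p : B.pos.{u}.cell (n + 1),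
      (τV p).WF ∧ (τV p).ty = S.Sph.map τ (S.freeBdry B.pos p)

/-- The support: the set of `(n + 1)`-dimensional generators that appear in a formal cell. -/
def supp : PreCell C → Set C.Gen
  | .var v => {v}
  | .coh _ _ _ _ _ τV => ⋃ p, (τV p).supp

end PreCell

namespace Computad

/-- The `(n + 1)`-cells of an `(n + 1)`-computad. -/
def Cell (C : Computad S) : Type u := {c : PreCell C // c.WF}

namespace Cell

variable {C : Computad S}

/-- The boundary sphere of a cell. -/
def ty (c : C.Cell) : S.Sph.obj C.base := c.1.ty

/-- The support of a cell. -/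
def supp (c : C.Cell) : Set C.Gen := c.1.supp

/-- A generator, seen as a cell. -/
def var (v : C.Gen) : C.Cell := ⟨.var v, trivial⟩

end Cell

/-- An `(n + 1)`-homomorphism: an `n`-homomorphism between the underlying `n`-computads and an
assignment of cells to generators, compatible with boundary spheres. -/
@[ext]
structure Hom (D C : Computad S) : Type u where
  base : D.base ⟶ C.base
  onGen : D.Gen → C.Cell
  ty_onGen : ∀ v, (onGen v).ty = S.Sph.map base (D.bdry v)

end Computad

/-- The action of an `(n + 1)`-homomorphism on formal cells, `coh B A τ ↦ coh B A (σ ∘ τ)`. -/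
def PreCell.map {C D : Computad S} (σ : C.Hom D) : PreCell C → PreCell D
  | .var v => (σ.onGen v).1
  | .coh B hB A hA τ τV => .coh B hB A hA (τ ≫ σ.base) (fun p => (τV p).map σ)

theorem PreCell.ty_map {C D : Computad S} (σ : C.Hom D) (c : PreCell C) :
    (c.map σ).ty = S.Sph.map σ.base c.ty := by
  cases c with
  | var v => exact σ.ty_onGen v
  | coh B hB A hA τ τV => simp [PreCell.map, PreCell.ty]

theorem PreCell.WF.map {C D : Computad S} (σ : C.Hom D) {c : PreCell C} (h : c.WF) :
    (c.map σ).WF := by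
  induction c with
  | var v => exact (σ.onGen v).2
  | coh B hB A hA τ τV ih =>
    intro p
    refine ⟨ih p (h p).1, ?_⟩
    rw [PreCell.ty_map, (h p).2]
    simp

namespace Computad

/-- The action of an `(n + 1)`-homomorphism on `(n + 1)`-cells. -/
def Cell.map {C D : Computad S} (σ : C.Hom D) (c : C.Cell) : D.Cell := ⟨c.1.map σ, c.2.map σ⟩

theorem Cell.ty_map {C D : Computad S} (σ : C.Hom D) (c : C.Cell) :
    (c.map σ).ty = S.Sph.map σ.base c.ty := PreCell.ty_map σ c.1

/-- The identity homomorphism. -/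
def Hom.id (C : Computad S) : C.Hom C where
  base := 𝟙 C.base
  onGen v := Cell.var v
  ty_onGen v := by rw [S.Sph.map_id]; rfl

/-- The composite of `τ : C ⟶ D` and `σ : D ⟶ E`. -/
def Hom.comp {C D E : Computad S} (τ : C.Hom D) (σ : D.Hom E) : C.Hom E where
  base := τ.base ≫ σ.base
  onGen v := (τ.onGen v).map σ
  ty_onGen v := by rw [Cell.ty_map, τ.ty_onGen]; simp

theorem Cell.map_id {C : Computad S} (c : C.Cell) : c.map (Hom.id C) = c := by
  obtain ⟨c, hc⟩ := c
  apply Subtype.ext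
  change c.map (Hom.id C) = c
  clear hc
  induction c with
  | var v => rfl
  | coh B hB A hA τ τV ih =>
    simp only [PreCell.map, ih]
    congr 1
    exact Category.comp_id τ

theorem Cell.map_comp {C D E : Computad S} (τ : C.Hom D) (σ : D.Hom E) (c : C.Cell) :
    c.map (τ.comp σ) = (c.map τ).map σ := by
  obtain ⟨c, hc⟩ := c
  apply Subtype.ext
  change c.map (τ.comp σ) = (c.map τ).map σ
  clear hc
  induction c with
  | var v => rfl
  | coh B hB A hA τ τV ih =>
    simp only [PreCell.map, ih]
    congr 1
    exact (Category.assoc _ _ _).symm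

instance : Category.{u} (Computad S) where
  Hom C D := C.Hom D
  id C := Hom.id C
  comp τ σ := τ.comp σ
  id_comp _ := Hom.ext (Category.id_comp _) rfl
  comp_id _ := Hom.ext (Category.comp_id _) (funext fun _ => Cell.map_id _)
  assoc _ _ _ := Hom.ext (Category.assoc _ _ _) (funext fun _ => (Cell.map_comp _ _ _).symm)

/-- An `(n + 1)`-sphere: an `n`-sphere together with two cells having it as boundary. -/
@[ext]
structure Sphere (C : Computad S) : Type u where
  bdry : S.Sph.obj C.base
  fst : C.Cell
  snd : C.Cell
  ty_fst : fst.ty = bdry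
  ty_snd : snd.ty = bdry

/-- The action of an `(n + 1)`-homomorphism on `(n + 1)`-spheres. -/
def Sphere.map {C D : Computad S} (σ : C ⟶ D) (A : C.Sphere) : D.Sphere where
  bdry := S.Sph.map σ.base A.bdry
  fst := A.fst.map σ
  snd := A.snd.map σ
  ty_fst := by rw [Cell.ty_map, A.ty_fst]
  ty_snd := by rw [Cell.ty_map, A.ty_snd]

variable (S) in
/-- The functor of `(n + 1)`-cells. -/
def cellFunctor : Computad S ⥤ Type u where
  obj C := C.Cell
  map σ := ↾(Cell.map σ)
  map_id C := by ext c; exact Cell.map_id c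
  map_comp τ σ := by ext c; exact Cell.map_comp τ σ c

variable (S) in
/-- The functor of `(n + 1)`-spheres. -/
def sphFunctor : Computad S ⥤ Type u where
  obj C := C.Sphere
  map σ := ↾(Sphere.map σ)
  map_id C := by
    apply ConcreteCategory.hom_ext
    intro A
    exact Sphere.ext (map_id_apply S.Sph C.base A.bdry) (Cell.map_id A.fst) (Cell.map_id A.snd)
  map_comp τ σ := by
    apply ConcreteCategory.hom_ext
    intro A
    exact Sphere.ext (map_comp_apply S.Sph τ.base σ.base A.bdry) (Cell.map_comp τ σ A.fst)
      (Cell.map_comp τ σ A.snd)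

variable (S) in
/-- The `(n + 1)`-computad on a globular set: its `(n + 1)`-dimensional generators are the
`(n + 1)`-cells of the globular set. -/
def free (X : Glob.{u}) : Computad S where
  base := S.Free.obj X
  Gen := X.cell (n + 1)
  bdry x := S.freeBdry X x

variable (S) in
/-- The action of `Computad.free` on morphisms of globular sets. -/
def freeMap {X Y : Glob.{u}} (f : X ⟶ Y) : free S X ⟶ free S Y where
  base := S.Free.map f
  onGen x := Cell.var (f.app (n + 1) x)
  ty_onGen x := by
    change S.freeBdry Y (f.app (n + 1) x) = S.Sph.map (S.Free.map f) (S.freeBdry X x)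
    simp only [freeBdry, sph_map_posSph]
    congr 1
    · exact f.src_app x
    · exact f.tgt_app x

variable (S) in
/-- The functor sending a globular set to its `(n + 1)`-computad. -/
def freeFunctor : Glob.{u} ⥤ Computad S where
  obj X := free S X
  map f := freeMap S f
  map_id X := Hom.ext (S.Free.map_id X) rfl
  map_comp f g := Hom.ext (S.Free.map_comp f g) rfl

/-- The `(n + 1)`-sphere of `Free X` given by two parallel `(n + 1)`-cells of `X`. -/
def posSphere (X : Glob.{u}) (a b : X.cell (n + 1)) (h : X.Parallel a b) :
    (free S X).Sphere where
  bdry := S.freeBdry X a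
  fst := Cell.var (C := free S X) a
  snd := Cell.var (C := free S X) b
  ty_fst := rfl
  ty_snd := by
    change S.freeBdry X b = S.freeBdry X a
    simp only [freeBdry, h.1, h.2]

/-- An `(n + 1)`-sphere `(A, a, b)` of a tree is full when the support of `a` is the set of
source boundary positions, the support of `b` is the set of target boundary positions, and
`A` is full. -/
def IsFull (B : Bat) (A : (free S B.pos).Sphere) : Prop :=
  A.fst.supp = B.srcBoundary (n + 1) ∧ A.snd.supp = B.tgtBoundary (n + 1) ∧ A.bdry ∈ S.Full B

variable (S) in
/-- The forgetful functor from `(n + 1)`-computads to `n`-computads. -/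
def forget : Computad S ⥤ S.Comp where
  obj C := C.base
  map σ := σ.base

end Computad

variable (S) in
/-- The data in dimension `n + 1` built from the data in dimension `n`. -/
def succ : Stage.{u} (n + 1) where
  Comp := Computad S
  Cell := Computad.cellFunctor S
  Sph := Computad.sphFunctor S
  fst := { app := fun _ => ↾(fun A => A.fst) }
  snd := { app := fun _ => ↾(fun A => A.snd) }
  sph_ext := fun A A' h h' =>
    Computad.Sphere.ext (A.ty_fst.symm.trans ((congrArg Computad.Cell.ty h).trans A'.ty_fst)) h h'
  Free := Computad.freeFunctor S
  gen := fun X x => Computad.Cell.var (C := Computad.free S X) x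
  gen_map := fun _ _ => rfl
  posSph := fun X a b h => Computad.posSphere X a b h
  fst_posSph := fun _ _ _ _ => rfl
  snd_posSph := fun _ _ _ _ => rfl
  Full := fun B => {A | Computad.IsFull B A}

end Succ

end Stage

/-- The data of `n`-computads, for every `n`. -/
def stage : ∀ n : ℕ, Stage.{u} n
  | 0 => Stage.zero
  | n + 1 => (stage n).succ

/-- The category of `n`-computads and `n`-homomorphisms. -/
abbrev CompN (n : ℕ) : Type (u + 1) := (stage.{u} n).Comp

/-- The set of `n`-cells of an `n`-computad. -/
abbrev CellN (n : ℕ) : CompN.{u} n ⥤ Type u := (stage.{u} n).Cell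

/-- The set of `n`-spheres of an `n`-computad. -/
abbrev SphN (n : ℕ) : CompN.{u} n ⥤ Type u := (stage.{u} n).Sph

/-- The `n`-computad on a globular set. -/
abbrev FreeN (n : ℕ) : Glob.{u} ⥤ CompN.{u} n := (stage.{u} n).Free

/-- The forgetful functor from `(n + 1)`-computads to `n`-computads. -/
def forgetN (n : ℕ) : CompN.{u} (n + 1) ⥤ CompN.{u} n := Stage.Computad.forget (stage.{u} n)

/-- The boundary `n`-sphere of an `(n + 1)`-cell. -/
def tyN (n : ℕ) : CellN.{u} (n + 1) ⟶ forgetN.{u} n ⋙ SphN.{u} n where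
  app C := ↾(fun c : Stage.Computad.Cell C => c.ty)
  naturality _ _ σ := by ext c; exact Stage.Computad.Cell.ty_map σ c

/-- The two cells of a sphere of positive dimension have the same boundary. -/
theorem tyN_fst_eq_tyN_snd (n : ℕ) (C : CompN.{u} (n + 1)) (A : (SphN.{u} (n + 1)).obj C) :
    (tyN n).app C ((stage.{u} (n + 1)).fst.app C A) =
      (tyN n).app C ((stage.{u} (n + 1)).snd.app C A) :=
  (Stage.Computad.Sphere.ty_fst A).trans (Stage.Computad.Sphere.ty_snd A).symm

/-! ### Computads -/

/-- Computads: objects of the limit of the forgetful functors between the categories of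
`n`-computads. -/
structure Comp : Type (u + 1) where
  trunc : ∀ n : ℕ, CompN.{u} n
  forget_trunc : ∀ n : ℕ, (forgetN n).obj (trunc (n + 1)) = trunc n

namespace Comp

/-- The identification of the underlying `n`-computad of the `(n + 1)`-truncation of `C` with
its `n`-truncation. -/
def glue (C : Comp.{u}) (n : ℕ) : (forgetN n).obj (C.trunc (n + 1)) ≅ C.trunc n :=
  eqToIso (C.forget_trunc n)

/-- Homomorphisms of computads: compatible sequences of `n`-homomorphisms. -/
@[ext]
structure Hom (C D : Comp.{u}) : Type u where
  trunc : ∀ n : ℕ, C.trunc n ⟶ D.trunc n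
  comm : ∀ n : ℕ, (forgetN n).map (trunc (n + 1)) ≫ (D.glue n).hom = (C.glue n).hom ≫ trunc n

instance : Category.{u} Comp.{u} where
  Hom C D := Hom C D
  id C := ⟨fun n => 𝟙 (C.trunc n), fun n => by simp⟩
  comp f g :=
    { trunc := fun n => f.trunc n ≫ g.trunc n
      comm := fun n => by
        rw [Functor.map_comp, Category.assoc, g.comm, ← Category.assoc, f.comm, Category.assoc] }

@[ext]
theorem hom_ext {C D : Comp.{u}} {f g : C ⟶ D} (h : ∀ n, f.trunc n = g.trunc n) : f = g :=
  Hom.ext (funext h)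

/-- The truncation functors from computads to `n`-computads. -/
def truncFunctor (n : ℕ) : Comp.{u} ⥤ CompN.{u} n where
  obj C := C.trunc n
  map σ := σ.trunc n

/-- The boundary sphere of an `(n + 1)`-cell of a computad. -/
def ty (C : Comp.{u}) (n : ℕ) (c : (CellN (n + 1)).obj (C.trunc (n + 1))) :
    (SphN n).obj (C.trunc n) :=
  (SphN n).map (C.glue n).hom ((tyN n).app (C.trunc (n + 1)) c)

theorem ty_map {C D : Comp.{u}} (σ : C ⟶ D) (n : ℕ)
    (c : (CellN (n + 1)).obj (C.trunc (n + 1))) :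
    D.ty n ((CellN (n + 1)).map (σ.trunc (n + 1)) c) =
      (SphN n).map (σ.trunc n) (C.ty n c) := by
  have h := congrArg (fun f => (SphN n).map f ((tyN n).app (C.trunc (n + 1)) c)) (σ.comm n)
  simp only [Functor.map_comp, types_comp_apply] at h
  unfold ty
  rw [← h, NatTrans.naturality_apply]
  rfl

theorem ty_fst_eq_ty_snd (C : Comp.{u}) (n : ℕ) (A : (SphN (n + 1)).obj (C.trunc (n + 1))) :
    C.ty n ((stage.{u} (n + 1)).fst.app _ A) = C.ty n ((stage.{u} (n + 1)).snd.app _ A) :=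
  congrArg ((SphN n).map (C.glue n).hom) (tyN_fst_eq_tyN_snd n _ A)

/-- The globular set of cells of a computad. -/
def cells (C : Comp.{u}) : Glob.{u} where
  cell n := (CellN n).obj (C.trunc n)
  src {n} c := (stage.{u} n).fst.app _ (C.ty n c)
  tgt {n} c := (stage.{u} n).snd.app _ (C.ty n c)
  src_src _ := congrArg _ (C.ty_fst_eq_ty_snd _ _)
  tgt_src _ := congrArg _ (C.ty_fst_eq_ty_snd _ _)

end Comp

/-- The functor sending a computad to its globular set of cells. -/
def Cell : Comp.{u} ⥤ Glob.{u} where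
  obj C := C.cells
  map {C D} σ :=
    { app := fun n => (CellN n).map (σ.trunc n)
      src_app := fun {n} x =>
        (congrArg ((stage.{u} n).fst.app (D.trunc n)) (Comp.ty_map σ n x)).trans
          (app_map_apply (stage.{u} n).fst (σ.trunc n) (C.ty n x))
      tgt_app := fun {n} x =>
        (congrArg ((stage.{u} n).snd.app (D.trunc n)) (Comp.ty_map σ n x)).trans
          (app_map_apply (stage.{u} n).snd (σ.trunc n) (C.ty n x)) }
  map_id C := Glob.hom_ext fun n x => map_id_apply (CellN n) (C.trunc n) x
  map_comp σ τ := Glob.hom_ext fun n x => map_comp_apply (CellN n) (σ.trunc n) (τ.trunc n) x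

/-- The free computad on a globular set. -/
def Free : Glob.{u} ⥤ Comp.{u} where
  obj X := ⟨fun n => (FreeN n).obj X, fun _ => rfl⟩
  map f := ⟨fun n => (FreeN n).map f, fun _ =>
    (Category.comp_id _).trans (Category.id_comp _).symm⟩
  map_id X := Comp.hom_ext fun n => (FreeN n).map_id X
  map_comp f g := Comp.hom_ext fun n => (FreeN n).map_comp f g

/-! ### The free computad adjunction and the free weak ω-category monad -/

theorem Free_ty_gen (X : Glob.{u}) (n : ℕ) (x : X.cell (n + 1)) :
    (Free.obj X).ty n ((stage.{u} (n + 1)).gen X x) = (stage.{u} n).freeBdry X x := by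
  change (SphN n).map (𝟙 _) _ = _
  rw [(SphN n).map_id]
  rfl

/-- The unit: every cell of `X` is a generator cell of the free computad on `X`. -/
def unit : 𝟭 Glob.{u} ⟶ Free.{u} ⋙ Cell.{u} where
  app X :=
    { app := fun n x => (stage.{u} n).gen X x
      src_app := fun {n} x => by
        change (stage.{u} n).fst.app _ ((Free.obj X).ty n _) = _
        rw [Free_ty_gen]
        exact (stage.{u} n).fst_posSph X _ _ _
      tgt_app := fun {n} x => by
        change (stage.{u} n).snd.app _ ((Free.obj X).ty n _) = _
        rw [Free_ty_gen]
        exact (stage.{u} n).snd_posSph X _ _ _ }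
  naturality _ _ f := Glob.hom_ext fun n x => ((stage.{u} n).gen_map f x).symm

/-- An `n`-homomorphism `Free C.cells ⟶ C` that restricts to the identity on `n`-cells. -/
structure CounitAt (C : Comp.{u}) (n : ℕ) where
  hom : (FreeN n).obj C.cells ⟶ C.trunc n
  hom_gen : ∀ c : C.cells.cell n, (CellN n).map hom ((stage.{u} n).gen C.cells c) = c

theorem CounitAt.map_freeBdry {C : Comp.{u}} {n : ℕ} (e : CounitAt C n)
    (c : C.cells.cell (n + 1)) :
    (SphN n).map e.hom ((stage.{u} n).freeBdry C.cells c) = C.ty n c := by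
  apply (stage.{u} n).sph_ext
  · rw [NatTrans.naturality_apply, Stage.freeBdry, Stage.fst_posSph, e.hom_gen]; rfl
  · rw [NatTrans.naturality_apply, Stage.freeBdry, Stage.snd_posSph, e.hom_gen]; rfl

/-- The counit in dimension `n`: it sends each generator of `Free C.cells`, which is a cell
of `C`, to that cell. -/
def counitAt (C : Comp.{u}) : ∀ n : ℕ, CounitAt C n
  | 0 => ⟨𝟙 (C.trunc 0), fun _ => rfl⟩
  | n + 1 =>
    { hom := Stage.Computad.Hom.mk (D := (FreeN.{u} (n + 1)).obj C.cells) (C := C.trunc (n + 1))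
        ((counitAt C n).hom ≫ (C.glue n).inv) (fun c => c) (fun c => by
          refine ((map_comp_apply (SphN n) (counitAt C n).hom (C.glue n).inv _).trans ?_).symm
          refine (congrArg ((SphN n).map (C.glue n).inv) ((counitAt C n).map_freeBdry c)).trans ?_
          exact (map_comp_apply (SphN n) (C.glue n).hom (C.glue n).inv _).symm.trans
            ((congrArg (fun f => (SphN n).map f _) (C.glue n).hom_inv_id).trans
              (map_id_apply (SphN n) _ _)))
      hom_gen := fun _ => rfl }

/-- The counit, as a homomorphism of computads. -/
def counitApp (C : Comp.{u}) : Free.obj C.cells ⟶ C where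
  trunc n := (counitAt C n).hom
  comm n := by
    change ((counitAt C n).hom ≫ (C.glue n).inv) ≫ (C.glue n).hom = 𝟙 _ ≫ _
    simp

/-- Homomorphisms out of a free computad are determined by their values on generators. -/
theorem Free_hom_ext {X : Glob.{u}} {C : Comp.{u}} {f g : Free.obj X ⟶ C}
    (h : ∀ n (x : X.cell n), (CellN n).map (f.trunc n) ((stage.{u} n).gen X x) =
      (CellN n).map (g.trunc n) ((stage.{u} n).gen X x)) : f = g := by
  apply Comp.hom_ext
  intro n
  induction n with
  | zero => exact ConcreteCategory.hom_ext (C := Type u) _ _ (h 0)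
  | succ n ih =>
    refine Stage.Computad.Hom.ext ?_ (funext fun x => h (n + 1) x)
    have hf := f.comm n
    have hg := g.comm n
    rw [ih, ← hg] at hf
    exact (Iso.cancel_iso_hom_right _ _ (C.glue n)).1 hf

/-- The functor `Free` is left adjoint to the functor `Cell`. -/
def freeCellAdj : Free.{u} ⊣ Cell.{u} where
  unit := unit
  counit :=
    { app := counitApp
      naturality := fun C D σ => Free_hom_ext fun n x =>
        ((map_comp_apply (CellN n) _ _ _).trans
          ((congrArg _ ((stage.{u} n).gen_map (Cell.map σ) x)).trans
            ((counitAt D n).hom_gen ((CellN n).map (σ.trunc n) x)))).trans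
        ((map_comp_apply (CellN n) _ _ _).trans
          (congrArg ((CellN n).map (σ.trunc n)) ((counitAt C n).hom_gen x))).symm }
  left_triangle_components X := Free_hom_ext fun n x =>
    ((map_comp_apply (CellN n) _ _ _).trans
      ((congrArg _ ((stage.{u} n).gen_map (unit.app X) x)).trans
        ((counitAt (Free.obj X) n).hom_gen ((stage.{u} n).gen X x)))).trans
    (map_id_apply (CellN n) _ _).symm
  right_triangle_components C := Glob.hom_ext fun n x => (counitAt C n).hom_gen x

/-- The free weak ω-category monad on globular sets, induced by the free computad adjunction. -/
def fcw : Monad Glob.{u} := freeCellAdj.{u}.toMonad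

/-- The category of (weak) ω-categories: algebras of the free weak ω-category monad. -/
abbrev OmegaCat : Type (u + 1) := fcw.{u}.Algebra

end WeakOmega

universe w v

-- A cell of a free computad is a term of finite arity: it is a generator, or it is `coh B A τ`,
-- where `τ` assigns data to the positions of a Batanin tree, finitely many in each dimension. Hence
-- a cell over a filtered colimit of globular sets already lives over some stage, and two cells of a
-- stage that agree in the colimit agree at a later stage. The induction on dimension treats cells,
-- spheres and homomorphisms out of trees simultaneously (`preservesFilteredColimitAt_stage`).
-- Lifting a homomorphism (`exists_lift_hom`) uses that finitely many boundary equations, true in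
-- the colimit, hold at some stage. Detecting equality (`eventually_eq_cell`) uses that maps of
-- globular sets send generators to generators, so a cell and its image have the same shape.
-- Colimits of globular sets are computed dimensionwise, so `fcw` is finitary.
--
-- Local presentability holds for algebras of any finitary monad `T` on `Glob`. The disks
-- corepresent cells and form a strong generator of finitely presentable objects; the free algebras
-- on them inherit both properties, the second because the forgetful functor preserves filtered
-- colimits. What remains is cocompleteness of the algebras (`hasColimits_algebra`). It follows from
-- the general adjoint functor theorem applied to constant-diagram functors: a cocone factors
-- through the subalgebra generated by its legs, and the cells of that subalgebra are named by
-- formal terms from a type that depends on the diagram but not on the vertex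
-- (`exists_smallAlgebra`).

namespace WeakOmega

open Limits Opposite

-- Limits and colimits of globular sets, computed dimensionwise.

namespace Glob

/-- The functor of `n`-cells of globular sets. -/
def eval (n : ℕ) : Glob.{u} ⥤ Type u where
  obj X := X.cell n
  map f := ↾(f.app n)

/-- Sources, as a natural transformation. -/
def evalSrc (n : ℕ) : eval.{u} (n + 1) ⟶ eval n where
  app X := ↾(X.src)
  naturality _ _ f := by ext x; exact f.src_app x

/-- Targets, as a natural transformation. -/
def evalTgt (n : ℕ) : eval.{u} (n + 1) ⟶ eval n where
  app X := ↾(X.tgt)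
  naturality _ _ f := by ext x; exact f.tgt_app x

theorem evalSrc_evalSrc (n : ℕ) :
    evalSrc.{u} (n + 1) ≫ evalSrc n = evalTgt (n + 1) ≫ evalSrc n := by
  ext X x
  exact X.src_src x

theorem evalSrc_evalTgt (n : ℕ) :
    evalSrc.{u} (n + 1) ≫ evalTgt n = evalTgt (n + 1) ≫ evalTgt n := by
  ext X x
  exact X.tgt_src x

/-- The globular set given by a sequence of types and of morphisms between them. -/
def ofTypes (F : ℕ → Type u) (s t : ∀ n, F (n + 1) ⟶ F n)
    (hs : ∀ n, s (n + 1) ≫ s n = t (n + 1) ≫ s n)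
    (ht : ∀ n, s (n + 1) ≫ t n = t (n + 1) ≫ t n) : Glob.{u} where
  cell := F
  src {n} x := s n x
  tgt {n} x := t n x
  src_src {n} x := ConcreteCategory.congr_hom (hs n) x
  tgt_src {n} x := ConcreteCategory.congr_hom (ht n) x

section Shape

variable {J : Type w} [Category.{v} J] {K : J ⥤ Glob.{u}}

/-- A cocone of globular sets is a colimit when it is one in every dimension. -/
def isColimitOfEval (c : Cocone K) (h : ∀ n, IsColimit ((eval n).mapCocone c)) :
    IsColimit c where
  desc s :=
    { app := fun n => (h n).desc ((eval n).mapCocone s)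
      src_app := fun {n} x => by
        -- Compatibility with sources is tested on the legs of the colimit in dimension `n + 1`,
        -- where it is naturality of `evalSrc`.
        have : (h (n + 1)).desc ((eval (n + 1)).mapCocone s) ≫ (evalSrc n).app s.pt =
            (evalSrc n).app c.pt ≫ (h n).desc ((eval n).mapCocone s) := by
          refine (h (n + 1)).hom_ext fun j => ?_
          refine ((h (n + 1)).fac_assoc ((eval (n + 1)).mapCocone s) j _).trans ?_
          refine ((evalSrc n).naturality (s.ι.app j)).trans ?_
          refine Eq.trans ?_ ((evalSrc n).naturality_assoc (c.ι.app j) _).symm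
          exact (congrArg ((evalSrc n).app (K.obj j) ≫ ·)
            ((h n).fac ((eval n).mapCocone s) j)).symm
        exact ConcreteCategory.congr_hom this x
      tgt_app := fun {n} x => by
        have : (h (n + 1)).desc ((eval (n + 1)).mapCocone s) ≫ (evalTgt n).app s.pt =
            (evalTgt n).app c.pt ≫ (h n).desc ((eval n).mapCocone s) := by
          refine (h (n + 1)).hom_ext fun j => ?_
          refine ((h (n + 1)).fac_assoc ((eval (n + 1)).mapCocone s) j _).trans ?_
          refine ((evalTgt n).naturality (s.ι.app j)).trans ?_
          refine Eq.trans ?_ ((evalTgt n).naturality_assoc (c.ι.app j) _).symm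
          exact (congrArg ((evalTgt n).app (K.obj j) ≫ ·)
            ((h n).fac ((eval n).mapCocone s) j)).symm
        exact ConcreteCategory.congr_hom this x }
  fac s j := hom_ext fun n x =>
    ConcreteCategory.congr_hom ((h n).fac ((eval n).mapCocone s) j) x
  uniq s m hm := hom_ext fun n x => by
    refine ConcreteCategory.congr_hom
      ((h n).uniq ((eval n).mapCocone s) ((eval n).map m) fun j => ?_) x
    change (eval n).map _ ≫ (eval n).map m = _
    rw [← Functor.map_comp, hm]
    rfl

/-- A cone of globular sets is a limit when it is one in every dimension. -/
def isLimitOfEval (c : Cone K) (h : ∀ n, IsLimit ((eval n).mapCone c)) : IsLimit c where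
  lift s :=
    { app := fun n => (h n).lift ((eval n).mapCone s)
      src_app := fun {n} x => by
        have : (h (n + 1)).lift ((eval (n + 1)).mapCone s) ≫ (evalSrc n).app c.pt =
            (evalSrc n).app s.pt ≫ (h n).lift ((eval n).mapCone s) := by
          refine (h n).hom_ext fun j => ?_
          rw [Category.assoc, Category.assoc, IsLimit.fac]
          refine (congrArg ((h (n + 1)).lift ((eval (n + 1)).mapCone s) ≫ ·)
            ((evalSrc n).naturality (c.π.app j))).symm.trans ?_
          refine Eq.trans ?_ ((evalSrc n).naturality (s.π.app j))
          exact (h (n + 1)).fac_assoc ((eval (n + 1)).mapCone s) j _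
        exact ConcreteCategory.congr_hom this x
      tgt_app := fun {n} x => by
        have : (h (n + 1)).lift ((eval (n + 1)).mapCone s) ≫ (evalTgt n).app c.pt =
            (evalTgt n).app s.pt ≫ (h n).lift ((eval n).mapCone s) := by
          refine (h n).hom_ext fun j => ?_
          rw [Category.assoc, Category.assoc, IsLimit.fac]
          refine (congrArg ((h (n + 1)).lift ((eval (n + 1)).mapCone s) ≫ ·)
            ((evalTgt n).naturality (c.π.app j))).symm.trans ?_
          refine Eq.trans ?_ ((evalTgt n).naturality (s.π.app j))
          exact (h (n + 1)).fac_assoc ((eval (n + 1)).mapCone s) j _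
        exact ConcreteCategory.congr_hom this x }
  fac s j := hom_ext fun n x =>
    ConcreteCategory.congr_hom ((h n).fac ((eval n).mapCone s) j) x
  uniq s m hm := hom_ext fun n x => by
    refine ConcreteCategory.congr_hom
      ((h n).uniq ((eval n).mapCone s) ((eval n).map m) fun j => ?_) x
    change (eval n).map m ≫ (eval n).map _ = _
    rw [← Functor.map_comp, hm]
    rfl

variable (K) in
/-- The pointwise colimit cocone of a diagram of globular sets. -/
noncomputable def colimitCocone [∀ n, HasColimit (K ⋙ eval n)] : Cocone K where
  pt := ofTypes (fun n => colimit (K ⋙ eval n))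
    (fun n => colimMap (Functor.whiskerLeft K (evalSrc n)))
    (fun n => colimMap (Functor.whiskerLeft K (evalTgt n)))
    (fun n => colimit.hom_ext fun j => by
      simpa using congrArg (fun f => f.app (K.obj j) ≫ colimit.ι (K ⋙ eval n) j)
        (evalSrc_evalSrc n))
    (fun n => colimit.hom_ext fun j => by
      simpa using congrArg (fun f => f.app (K.obj j) ≫ colimit.ι (K ⋙ eval n) j)
        (evalSrc_evalTgt n))
  ι :=
    { app := fun j =>
        { app := fun n x => colimit.ι (K ⋙ eval n) j x
          src_app := fun {n} x => ConcreteCategory.congr_hom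
            (ι_colimMap (Functor.whiskerLeft K (evalSrc n)) j) x
          tgt_app := fun {n} x => ConcreteCategory.congr_hom
            (ι_colimMap (Functor.whiskerLeft K (evalTgt n)) j) x }
      naturality := fun i j f => hom_ext fun n x =>
        ConcreteCategory.congr_hom (colimit.w (K ⋙ eval n) f) x }

variable (K) in
/-- The pointwise limit cone of a diagram of globular sets. -/
noncomputable def limitCone [∀ n, HasLimit (K ⋙ eval n)] : Cone K where
  pt := ofTypes (fun n => limit (K ⋙ eval n))
    (fun n => limMap (Functor.whiskerLeft K (evalSrc n)))
    (fun n => limMap (Functor.whiskerLeft K (evalTgt n)))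
    (fun n => limit.hom_ext fun j => by
      simpa using congrArg (fun f => limit.π (K ⋙ eval (n + 2)) j ≫ f.app (K.obj j))
        (evalSrc_evalSrc n))
    (fun n => limit.hom_ext fun j => by
      simpa using congrArg (fun f => limit.π (K ⋙ eval (n + 2)) j ≫ f.app (K.obj j))
        (evalSrc_evalTgt n))
  π :=
    { app := fun j =>
        { app := fun n x => limit.π (K ⋙ eval n) j x
          src_app := fun {n} x => (ConcreteCategory.congr_hom
            (limMap_π (Functor.whiskerLeft K (evalSrc n)) j) x).symm
          tgt_app := fun {n} x => (ConcreteCategory.congr_hom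
            (limMap_π (Functor.whiskerLeft K (evalTgt n)) j) x).symm }
      naturality := fun i j f => hom_ext fun n x =>
        (ConcreteCategory.congr_hom (limit.w (K ⋙ eval n) f) x).symm }

variable (K) in
/-- The pointwise colimit cocone is a colimit. -/
noncomputable def isColimitColimitCocone [∀ n, HasColimit (K ⋙ eval n)] :
    IsColimit (colimitCocone K) :=
  isColimitOfEval _ fun n => (colimit.isColimit (K ⋙ eval n)).ofIsoColimit
    (Cocone.ext (Iso.refl _) fun _ => rfl)

variable (K) in
/-- The pointwise limit cone is a limit. -/
noncomputable def isLimitLimitCone [∀ n, HasLimit (K ⋙ eval n)] : IsLimit (limitCone K) :=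
  isLimitOfEval _ fun n => (limit.isLimit (K ⋙ eval n)).ofIsoLimit
    (Cone.ext (Iso.refl _) fun _ => rfl)

/-- It is enough to test one colimit cocone, and `eval n` sends the pointwise one to the chosen
colimit of types. -/
instance (n : ℕ) [∀ n, HasColimit (K ⋙ eval n)] : PreservesColimit K (eval.{u} n) :=
  preservesColimit_of_preserves_colimit_cocone (isColimitColimitCocone K)
    ((colimit.isColimit (K ⋙ eval n)).ofIsoColimit (Cocone.ext (Iso.refl _) fun _ => rfl))

end Shape

instance : HasColimitsOfSize.{u, u} Glob.{u} where
  has_colimits_of_shape _ _ :=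
    { has_colimit := fun K => ⟨⟨_, isColimitColimitCocone K⟩⟩ }

instance : HasLimitsOfSize.{u, u} Glob.{u} where
  has_limits_of_shape _ _ :=
    { has_limit := fun K => ⟨⟨_, isLimitLimitCone K⟩⟩ }

instance (n : ℕ) : PreservesColimitsOfSize.{u, u} (eval.{u} n) where
  preservesColimitsOfShape := { preservesColimit := inferInstance }

theorem isIso_of_bijective {X Y : Glob.{u}} (f : X ⟶ Y)
    (h : ∀ n, Function.Bijective (f.app n)) : IsIso f := by
  let e n := Equiv.ofBijective _ (h n)
  have he n (x : X.cell n) : f.app n x = e n x := rfl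
  refine ⟨⟨fun n => (e n).symm, fun {n} x => ?_, fun {n} x => ?_⟩, ?_, ?_⟩
  · rw [Equiv.eq_symm_apply, ← he, ← f.src_app, he, Equiv.apply_symm_apply]
  · rw [Equiv.eq_symm_apply, ← he, ← f.tgt_app, he, Equiv.apply_symm_apply]
  · exact hom_ext fun n x => (e n).symm_apply_apply x
  · exact hom_ext fun n x => (e n).apply_symm_apply x

/-! ### Disks -/

/-- The `n`-disk: the globular set with one `n`-cell, two `m`-cells for `m < n`, and no cell of
dimension larger than `n`. -/
def disk (n : ℕ) : Glob.{u} where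
  -- The tag `false` marks the source and `true` the target; in dimension `n` only `true` remains,
  -- so that tag occurs in every dimension up to `n`.
  cell m := {b : ULift.{u} Bool // m < n ∨ m = n ∧ b.down = true}
  src x := ⟨⟨false⟩, Or.inl (by omega)⟩
  tgt x := ⟨⟨true⟩, Or.inl (by omega)⟩
  src_src _ := rfl
  tgt_src _ := rfl

/-- The `n`-cell of the `n`-disk. -/
def diskTop (n : ℕ) : (disk.{u} n).cell n := ⟨⟨true⟩, Or.inr ⟨rfl, rfl⟩⟩

/-- The iterated source and target of an `n`-cell, in every dimension `m ≤ n`. -/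
def bdryPair {X : Glob.{u}} {n : ℕ} (x : X.cell n) (m : ℕ) (h : m ≤ n) :
    X.cell m × X.cell m :=
  Nat.decreasingInduction (motive := fun m _ => X.cell m × X.cell m)
    -- Descending along the first component loses nothing, since the two components are parallel. In
    -- dimension `n` the pair is `(x, x)` by convention.
    (fun _ _ p => (X.src p.1, X.tgt p.1)) (x, x) h

theorem bdryPair_self {X : Glob.{u}} {n : ℕ} (x : X.cell n) :
    bdryPair x n le_rfl = (x, x) := Nat.decreasingInduction_self _ _

theorem bdryPair_of_lt {X : Glob.{u}} {n : ℕ} (x : X.cell n) {m : ℕ} (h : m + 1 ≤ n) :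
    bdryPair x m (Nat.le_of_succ_le h) =
      (X.src (bdryPair x (m + 1) h).1, X.tgt (bdryPair x (m + 1) h).1) :=
  Nat.decreasingInduction_succ_left _ _ _ _

theorem parallel_bdryPair {X : Glob.{u}} {n : ℕ} (x : X.cell n) {m : ℕ} (h : m ≤ n) :
    X.Parallel (bdryPair x m h).1 (bdryPair x m h).2 := by
  rcases h.eq_or_lt with rfl | h
  · rw [bdryPair_self]
    cases m
    · trivial
    · exact ⟨rfl, rfl⟩
  · rw [bdryPair_of_lt x h]
    exact X.parallel_src_tgt _

/-- The morphism from the `n`-disk that corresponds to an `n`-cell. -/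
def diskLift {X : Glob.{u}} {n : ℕ} (x : X.cell n) : disk.{u} n ⟶ X where
  app m b := bif b.1.down then (bdryPair x m (by have := b.2; omega)).2
    else (bdryPair x m (by have := b.2; omega)).1
  src_app {m} b := by
    have h : m + 1 ≤ n := by have := b.2; omega
    -- For the tag `true` the cell is the second component, while `bdryPair` descends along the
    -- first; parallelism bridges the two.
    have hp := parallel_bdryPair x h
    obtain ⟨⟨_ | _⟩, hb⟩ := b
    · exact (congrArg Prod.fst (bdryPair_of_lt x h)).symm
    · exact hp.1.symm.trans (congrArg Prod.fst (bdryPair_of_lt x h)).symm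
  tgt_app {m} b := by
    have h : m + 1 ≤ n := by have := b.2; omega
    have hp := parallel_bdryPair x h
    obtain ⟨⟨_ | _⟩, hb⟩ := b
    · exact (congrArg Prod.snd (bdryPair_of_lt x h)).symm
    · exact hp.2.symm.trans (congrArg Prod.snd (bdryPair_of_lt x h)).symm

theorem diskLift_top {X : Glob.{u}} {n : ℕ} (x : X.cell n) :
    (diskLift x).app n (diskTop n) = x :=
  congrArg Prod.snd (bdryPair_self x)

/-- Downward induction on dimension: below `n`, every cell of the disk is the source or the target
of a cell one dimension up. -/
theorem disk_hom_ext {X : Glob.{u}} {n : ℕ} {f g : disk.{u} n ⟶ X}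
    (h : f.app n (diskTop n) = g.app n (diskTop n)) : f = g := by
  have main : ∀ m (_ : m ≤ n) (b : (disk.{u} n).cell m), f.app m b = g.app m b := by
    intro m hm
    induction hm using Nat.decreasingInduction with
    | self =>
      intro b
      have hb : b = diskTop n := by
        obtain ⟨⟨b⟩, hb⟩ := b
        have : b = true := by simpa using hb
        subst this
        rfl
      rw [hb, h]
    | of_succ m hm ih =>
      intro b
      have ht : (disk.{u} n).cell (m + 1) := ⟨⟨true⟩, by
        rcases Nat.lt_or_eq_of_le hm with h | h
        · exact Or.inl h
        · exact Or.inr ⟨h, rfl⟩⟩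
      obtain ⟨⟨_ | _⟩, hb⟩ := b
      · exact (f.src_app ht).symm.trans ((congrArg X.src (ih ht)).trans (g.src_app ht))
      · exact (f.tgt_app ht).symm.trans ((congrArg X.tgt (ih ht)).trans (g.tgt_app ht))
  exact hom_ext fun m b => main m (by have := b.2; omega) b

/-- Morphisms from the `n`-disk are `n`-cells. -/
def diskHomEquiv (n : ℕ) (X : Glob.{u}) : (disk.{u} n ⟶ X) ≃ X.cell n where
  toFun f := f.app n (diskTop n)
  invFun x := diskLift x
  left_inv _ := disk_hom_ext (diskLift_top _)
  right_inv x := diskLift_top x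

/-- The functor of `n`-cells is corepresented by the `n`-disk. -/
def coyonedaDiskIso (n : ℕ) : coyoneda.obj (op (disk.{u} n)) ≅ eval n :=
  NatIso.ofComponents (fun X => (diskHomEquiv n X).toIso) fun _ => rfl

/-- The functor corepresented by the disk is `eval n`, which preserves all small colimits. -/
instance (κ : Cardinal.{u}) [Fact κ.IsRegular] (n : ℕ) :
    IsCardinalPresentable (disk.{u} n) κ where
  preservesColimitOfShape _ _ _ := preservesColimitsOfShape_of_natIso (coyonedaDiskIso n).symm

theorem mono_app_injective {X Y : Glob.{u}} (f : X ⟶ Y) [Mono f] (n : ℕ) :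
    Function.Injective (f.app n) := fun x y h => by
  have : diskLift x = diskLift y := by
    rw [← cancel_mono f]
    apply disk_hom_ext
    change f.app n ((diskLift x).app n _) = f.app n ((diskLift y).app n _)
    rw [diskLift_top, diskLift_top, h]
  rw [← diskLift_top x, this, diskLift_top]

/-- Maps out of disks are cells, so they separate morphisms, and a monomorphism through which all of
them factor is bijective in each dimension. -/
theorem isStrongGenerator_disk :
    (ObjectProperty.ofObj disk.{u}).IsStrongGenerator := by
  rw [ObjectProperty.isStrongGenerator_iff]
  refine ⟨fun X Y f g h => hom_ext fun n x => ?_, fun X Y f _ h => ?_⟩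
  · have := congrArg (fun k => Hom.app k n (diskTop n))
      (h (disk n) (ObjectProperty.ofObj_apply _ n) (diskLift x))
    change f.app n ((diskLift x).app n _) = g.app n ((diskLift x).app n _) at this
    rwa [diskLift_top] at this
  · refine isIso_of_bijective f fun n => ⟨mono_app_injective f n, fun y => ?_⟩
    obtain ⟨g, hg⟩ := h (disk n) (ObjectProperty.ofObj_apply _ n) (diskLift y)
    refine ⟨g.app n (diskTop n), ?_⟩
    exact (congrArg (fun k => Hom.app k n (diskTop n)) hg).trans (diskLift_top y)

instance (κ : Cardinal.{u}) [Fact κ.IsRegular] : IsCardinalLocallyPresentable Glob.{u} κ := by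
  rw [IsCardinalLocallyPresentable.iff_exists_isStrongGenerator]
  refine ⟨_, inferInstance, isStrongGenerator_disk, ?_⟩
  rintro _ ⟨n⟩
  rw [isCardinalPresentable_iff]
  infer_instance

end Glob

/-! ### Finiteness of the positions of a Batanin tree -/

mutual
/-- A Batanin tree has finitely many positions in every dimension. -/
theorem finite_pos : ∀ (B : Bat) (n : ℕ), Finite (Pos.{u} B n)
  | .br L, n => finite_pos_br L n
/-- The tree `br L` has finitely many positions in every dimension. -/
theorem finite_pos_br : ∀ (L : List Bat) (n : ℕ), Finite (Pos.{u} (.br L) n)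
  | [], 0 => Finite.of_surjective (fun _ : Unit => Pos.here _) fun p => by
      cases p; exact ⟨(), rfl⟩
  | [], n + 1 => Finite.of_surjective (fun x : Empty => x.elim) fun p => by cases p
  | B :: L, 0 => by
      have := finite_pos_br L 0
      refine Finite.of_surjective (α := Option (Pos.{u} (.br L) 0))
        (fun x => x.elim (.here _) .inr) fun p => ?_
      cases p with
      | here => exact ⟨none, rfl⟩
      | inr p => exact ⟨some p, rfl⟩
  | B :: L, n + 1 => by
      have := finite_pos_br L (n + 1)
      have := finite_pos B n
      refine Finite.of_surjective (α := Pos.{u} (.br L) (n + 1) ⊕ Pos.{u} B n)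
        (Sum.elim .inr .inl) fun p => ?_
      cases p with
      | inr p => exact ⟨.inl p, rfl⟩
      | inl p => exact ⟨.inr p, rfl⟩
end

instance (B : Bat) (n : ℕ) : Finite (B.pos.{u}.cell n) := finite_pos B n

/-! ### Filtered colimits of types, in terms of elements -/

section FilteredColimits

/-- Each condition persists once it holds, so finitely many stages can be merged into one by
filteredness. -/
theorem exists_hom_forall_of_finite {J : Type w} [Category.{v} J] [IsFiltered J]
    {α : Type*} [Finite α] {j : J} (Q : α → ∀ k, (j ⟶ k) → Prop)
    (hQ : ∀ a k f l (g : k ⟶ l), Q a k f → Q a l (f ≫ g))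
    (h : ∀ a, ∃ k f, Q a k f) : ∃ k f, ∀ a, Q a k f := by
  have := Fintype.ofFinite α
  suffices ∀ s : Finset α, ∃ k f, ∀ a ∈ s, Q a k f by
    simpa using this Finset.univ
  intro s
  induction s using Finset.cons_induction with
  | empty => exact ⟨j, 𝟙 j, by simp⟩
  | cons a s _ ih =>
    obtain ⟨k, f, hf⟩ := ih
    obtain ⟨l, g, hg⟩ := h a
    obtain ⟨m, p, q, hpq⟩ := IsFiltered.span f g
    refine ⟨m, f ≫ p, fun b hb => ?_⟩
    rcases Finset.mem_cons.1 hb with rfl | hb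
    · rw [hpq]
      exact hQ _ _ _ _ _ hg
    · exact hQ _ _ _ _ _ (hf b hb)

variable {C : Type w} [Category.{v} C] {J : Type u} [Category.{u} J]

/-- The image of the cocone `c` by `F` is jointly surjective, and two elements at the same stage
that it identifies are identified at a later stage. -/
structure IsFilteredColimitAt (F : C ⥤ Type u) {K : J ⥤ C} (c : Cocone K) : Prop where
  surj : ∀ x : F.obj c.pt, ∃ (j : J) (y : F.obj (K.obj j)), F.map (c.ι.app j) y = x
  inj : ∀ {j : J} (x y : F.obj (K.obj j)), F.map (c.ι.app j) x = F.map (c.ι.app j) y →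
    ∃ (k : J) (f : j ⟶ k), F.map (K.map f) x = F.map (K.map f) y

theorem map_app_map_apply (F : C ⥤ Type u) {K : J ⥤ C} (c : Cocone K) {j k : J} (f : j ⟶ k)
    (x : F.obj (K.obj j)) :
    F.map (c.ι.app k) (F.map (K.map f) x) = F.map (c.ι.app j) x := by
  rw [← map_comp_apply, c.w]

variable [IsFiltered J]

theorem isFilteredColimitAt_of_isColimit (F : C ⥤ Type u) {K : J ⥤ C} {c : Cocone K}
    (hc : IsColimit (F.mapCocone c)) : IsFilteredColimitAt F c where
  surj x := Types.jointly_surjective_of_isColimit hc x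
  inj x y h := (Types.FilteredColimit.isColimit_eq_iff' hc x y).1 h

namespace IsFilteredColimitAt

variable {F : C ⥤ Type u} {K : J ⥤ C} {c : Cocone K}

/-- A cocone as in `IsFilteredColimitAt` is sent to a colimit cocone. -/
noncomputable def isColimit (h : IsFilteredColimitAt F c) : IsColimit (F.mapCocone c) :=
  Types.FilteredColimit.isColimitOf' _ _
    (fun x => by obtain ⟨j, y, hy⟩ := h.surj x; exact ⟨j, y, hy.symm⟩)
    (fun _ x y hxy => h.inj x y hxy)

theorem exists_lift_of_finite (h : IsFilteredColimitAt F c) {α : Type*} [Finite α]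
    (x : α → F.obj c.pt) : ∃ (k : J) (y : α → F.obj (K.obj k)),
      ∀ a, F.map (c.ι.app k) (y a) = x a := by
  have : Nonempty J := IsFiltered.nonempty
  obtain ⟨k, f, hf⟩ := exists_hom_forall_of_finite (j := Classical.arbitrary J)
    (fun a k _ => ∃ y : F.obj (K.obj k), F.map (c.ι.app k) y = x a)
    (fun a k f l g ⟨y, hy⟩ => ⟨F.map (K.map g) y, by rw [map_app_map_apply, hy]⟩)
    (fun a => by
      obtain ⟨k, y, hy⟩ := h.surj (x a)
      exact ⟨IsFiltered.max _ k, IsFiltered.leftToMax _ k,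
        F.map (K.map (IsFiltered.rightToMax _ k)) y, by rw [map_app_map_apply, hy]⟩)
  choose y hy using hf
  exact ⟨k, y, hy⟩

theorem eventually_eq_of_finite (h : IsFilteredColimitAt F c) {α : Type*} [Finite α] {j : J}
    (x y : α → F.obj (K.obj j))
    (hxy : ∀ a, F.map (c.ι.app j) (x a) = F.map (c.ι.app j) (y a)) :
    ∃ (k : J) (f : j ⟶ k), ∀ a, F.map (K.map f) (x a) = F.map (K.map f) (y a) :=
  exists_hom_forall_of_finite (fun a k f => F.map (K.map f) (x a) = F.map (K.map f) (y a))
    (fun a k f l g e => by rw [K.map_comp, map_comp_apply, e, ← map_comp_apply])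
    (fun a => h.inj _ _ (hxy a))

end IsFilteredColimitAt

end FilteredColimits

-- Free computads and filtered colimits, by induction on the dimension.

namespace Stage

/-- The cells, spheres, and pasting diagrams of the free `n`-computads on the globular sets of a
cocone are filtered colimits. -/
structure PreservesFilteredColimitAt {n : ℕ} (S : Stage.{u} n) {J : Type u} [Category.{u} J]
    {K : J ⥤ Glob.{u}} (c : Cocone K) : Prop where
  cell : IsFilteredColimitAt (S.Free ⋙ S.Cell) c
  sph : IsFilteredColimitAt (S.Free ⋙ S.Sph) c
  -- Homomorphisms out of trees belong to the induction because a cell `coh B A τ` of the next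
  -- dimension contains one.
  hom : ∀ B : Bat, IsFilteredColimitAt (S.Free ⋙ coyoneda.obj (op (S.Free.obj B.pos))) c

variable {J : Type u} [Category.{u} J] [IsFiltered J] {K : J ⥤ Glob.{u}} {c : Cocone K}

/-- In dimension `0` a sphere is a pair of elements and a homomorphism out of a tree is a function
on its finitely many `0`-positions. Pairs are treated as families over `Bool`, with `true` for the
first entry. -/
theorem preservesFilteredColimitAt_zero (h : IsFilteredColimitAt (Glob.eval 0) c) :
    PreservesFilteredColimitAt zero c where
  cell := h
  sph :=
    { surj := fun x => by
        obtain ⟨k, y, hy⟩ := h.exists_lift_of_finite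
          (fun b : Bool => bif b then x.1 else x.2)
        exact ⟨k, (y true, y false), Prod.ext (hy true) (hy false)⟩
      inj := fun {j} x y hxy => by
        obtain ⟨k, f, hf⟩ := h.eventually_eq_of_finite
          (fun b : Bool => bif b then x.1 else x.2) (fun b : Bool => bif b then y.1 else y.2)
          (fun b => by
            cases b
            · exact congrArg Prod.snd hxy
            · exact congrArg Prod.fst hxy)
        exact ⟨k, f, Prod.ext (hf true) (hf false)⟩ }
  hom B :=
    { surj := fun x => by
        let x' : B.pos.cell 0 ⟶ c.pt.cell 0 := x
        obtain ⟨k, y, hy⟩ := h.exists_lift_of_finite (α := B.pos.cell 0) (fun p => x' p)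
        exact ⟨k, (↾y : B.pos.cell 0 ⟶ (K.obj k).cell 0),
          ConcreteCategory.hom_ext (C := Type u) _ _ hy⟩
      inj := fun {j} x y hxy => by
        let x' : B.pos.cell 0 ⟶ (K.obj j).cell 0 := x
        let y' : B.pos.cell 0 ⟶ (K.obj j).cell 0 := y
        obtain ⟨k, f, hf⟩ := h.eventually_eq_of_finite (α := B.pos.cell 0)
          (fun p => x' p) (fun p => y' p)
          (fun p => ConcreteCategory.congr_hom (C := Type u) hxy p)
        exact ⟨k, f, ConcreteCategory.hom_ext (C := Type u) _ _ hf⟩ }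

namespace Computad

variable {n : ℕ} {S : Stage.{u} n}

/-- The cell `coh B A σ`. -/
def Cell.coh {C : Computad S} (B : Bat) (hB : B.dim ≤ n + 1)
    (A : S.Sph.obj (S.Free.obj B.pos)) (hA : A ∈ S.Full B) (σ : free S B.pos ⟶ C) : C.Cell :=
  ⟨.coh B hB A hA σ.base fun p => (σ.onGen p).1, fun p => ⟨(σ.onGen p).2, σ.ty_onGen p⟩⟩

/-- Induction on the cells of a computad. -/
theorem Cell.induction {C : Computad S} {motive : C.Cell → Prop}
    (var : ∀ v, motive (Cell.var v))
    (coh : ∀ B hB A hA (σ : free S B.pos ⟶ C), (∀ p, motive (σ.onGen p)) →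
      motive (Cell.coh B hB A hA σ)) (c : C.Cell) : motive c := by
  obtain ⟨c, hc⟩ := c
  induction c with
  | var v => exact var v
  | coh B hB A hA τ τV ih =>
    exact coh B hB A hA
      (Hom.mk (D := free S B.pos) τ (fun p => ⟨τV p, (hc p).1⟩) fun p => (hc p).2)
      fun p => ih p _

theorem hom_ext {C D : Computad S} {σ τ : C ⟶ D} (h : σ.base = τ.base)
    (h' : ∀ v, σ.onGen v = τ.onGen v) : σ = τ := Hom.ext h (funext h')

theorem Cell.map_freeMap_comp {X Y Z : Glob.{u}} (f : X ⟶ Y) (g : Y ⟶ Z)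
    (x : (free S X).Cell) :
    x.map (freeMap S (f ≫ g)) = (x.map (freeMap S f)).map (freeMap S g) :=
  map_comp_apply (freeFunctor S ⋙ cellFunctor S) f g x

/-- The base and the values on finitely many positions are lifted to a common stage, and the
boundary conditions are then repaired at a later one. Only the values of `σ` are assumed to lift, so
that the lemma can serve inside the induction on cells. -/
theorem exists_lift_hom (h : PreservesFilteredColimitAt S c) {B : Bat}
    (σ : free S B.pos ⟶ free S c.pt)
    (hσ : ∀ p, ∃ (j : J) (y : (free S (K.obj j)).Cell),
      y.map (freeMap S (c.ι.app j)) = σ.onGen p) :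
    ∃ (j : J) (τ : free S B.pos ⟶ free S (K.obj j)), τ ≫ freeMap S (c.ι.app j) = σ := by
  obtain ⟨j, τ, hτ⟩ := (h.hom B).surj σ.base
  change τ ≫ S.Free.map (c.ι.app j) = σ.base at hτ
  obtain ⟨k, f, hf⟩ := exists_hom_forall_of_finite (j := j) (α := B.pos.cell (n + 1))
    (fun p k _ => ∃ y : (free S (K.obj k)).Cell, y.map (freeMap S (c.ι.app k)) = σ.onGen p)
    (fun p k f l g ⟨y, hy⟩ => ⟨y.map (freeMap S (K.map g)), by
      rw [← Cell.map_freeMap_comp, c.w, hy]⟩)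
    (fun p => by
      obtain ⟨k, y, hy⟩ := hσ p
      exact ⟨IsFiltered.max j k, IsFiltered.leftToMax j k,
        y.map (freeMap S (K.map (IsFiltered.rightToMax j k))), by
          rw [← Cell.map_freeMap_comp, c.w, hy]⟩)
  choose y hy using hf
  have hb : (τ ≫ S.Free.map (K.map f)) ≫ S.Free.map (c.ι.app k) = σ.base := by
    rw [Category.assoc, ← Functor.map_comp, c.w, hτ]
  -- The lifted values are known to have the required boundary only in the colimit; these are
  -- finitely many equations between spheres, so they hold from some stage on.
  obtain ⟨l, g, hg⟩ := h.sph.eventually_eq_of_finite (fun p => (y p).ty)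
    (fun p => S.Sph.map (τ ≫ S.Free.map (K.map f)) (S.freeBdry B.pos p)) (fun p => by
      refine (Cell.ty_map (freeMap S (c.ι.app k)) (y p)).symm.trans ?_
      rw [hy]
      refine (σ.ty_onGen p).trans ?_
      rw [← hb]
      exact map_comp_apply S.Sph _ _ _)
  refine ⟨l, Hom.mk (D := free S B.pos) (C := free S (K.obj l))
    ((τ ≫ S.Free.map (K.map f)) ≫ S.Free.map (K.map g))
    (fun p => (y p).map (freeMap S (K.map g))) (fun p => ?_), ?_⟩
  · refine (Cell.ty_map (freeMap S (K.map g)) (y p)).trans ((hg p).trans ?_)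
    exact (map_comp_apply S.Sph _ _ _).symm
  · refine hom_ext ?_ fun p => ?_
    · change ((τ ≫ S.Free.map (K.map f)) ≫ S.Free.map (K.map g)) ≫ S.Free.map (c.ι.app l) = _
      rw [Category.assoc, ← Functor.map_comp, c.w, hb]
    · change ((y p).map (freeMap S (K.map g))).map (freeMap S (c.ι.app l)) = _
      rw [← Cell.map_freeMap_comp, c.w]
      exact hy p

/-- As for lifting, agreement is assumed one position at a time, which is what the induction
hypothesis on cells provides. -/
theorem eventually_eq_hom (h : PreservesFilteredColimitAt S c) {B : Bat} {j : J}
    (σ τ : free S B.pos ⟶ free S (K.obj j))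
    (hb : σ.base ≫ S.Free.map (c.ι.app j) = τ.base ≫ S.Free.map (c.ι.app j))
    (hg : ∀ p, ∃ (k : J) (f : j ⟶ k),
      (σ.onGen p).map (freeMap S (K.map f)) = (τ.onGen p).map (freeMap S (K.map f))) :
    ∃ (k : J) (f : j ⟶ k), σ ≫ freeMap S (K.map f) = τ ≫ freeMap S (K.map f) := by
  obtain ⟨k, f, hf⟩ := (h.hom B).inj σ.base τ.base hb
  change σ.base ≫ S.Free.map (K.map f) = τ.base ≫ S.Free.map (K.map f) at hf
  obtain ⟨l, g, hg⟩ := exists_hom_forall_of_finite (j := j) (α := B.pos.cell (n + 1))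
    (fun p _ g => (σ.onGen p).map (freeMap S (K.map g)) =
      (τ.onGen p).map (freeMap S (K.map g)))
    (fun p k f l g e => by
      rw [K.map_comp, Cell.map_freeMap_comp, e, ← Cell.map_freeMap_comp]) hg
  -- The bases agree along `f` and the generators along `g`; the two arrows must become one.
  obtain ⟨m, p, q, hpq⟩ := IsFiltered.span f g
  refine ⟨m, f ≫ p, hom_ext ?_ fun v => ?_⟩
  · change σ.base ≫ S.Free.map (K.map (f ≫ p)) = τ.base ≫ S.Free.map (K.map (f ≫ p))
    rw [K.map_comp, S.Free.map_comp]
    exact (Category.assoc _ _ _).symm.trans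
      ((congrArg (· ≫ S.Free.map (K.map p)) hf).trans (Category.assoc _ _ _))
  · change (σ.onGen v).map (freeMap S (K.map (f ≫ p))) =
      (τ.onGen v).map (freeMap S (K.map (f ≫ p)))
    rw [hpq, K.map_comp, Cell.map_freeMap_comp]
    exact (congrArg (Cell.map (freeMap S (K.map q))) (hg v)).trans
      (Cell.map_freeMap_comp _ _ _).symm

/-- Induction on the cell: a homomorphism acts on `coh B A σ` by changing `σ` alone, so lifting `σ`
suffices. -/
theorem exists_lift_cell (h : PreservesFilteredColimitAt S c)
    (hn : IsFilteredColimitAt (Glob.eval (n + 1)) c) (x : (free S c.pt).Cell) :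
    ∃ (j : J) (y : (free S (K.obj j)).Cell), y.map (freeMap S (c.ι.app j)) = x := by
  induction x using Cell.induction with
  | var v =>
    obtain ⟨j, y, hy⟩ := hn.surj v
    exact ⟨j, Cell.var (C := free S (K.obj j)) y,
      congrArg (Cell.var (C := free S c.pt)) hy⟩
  | coh B hB A hA σ ih =>
    obtain ⟨j, τ, rfl⟩ := exists_lift_hom h σ ih
    exact ⟨j, Cell.coh B hB A hA τ, rfl⟩

/-- `freeMap` sends generators to generators, so it preserves the outermost constructor. Mixed cases
are therefore impossible, and injectivity of the constructors passes the equation to the arguments.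
-/
theorem eventually_eq_cell (h : PreservesFilteredColimitAt S c)
    (hn : IsFilteredColimitAt (Glob.eval (n + 1)) c) {j : J} (x y : (free S (K.obj j)).Cell)
    (hxy : x.map (freeMap S (c.ι.app j)) = y.map (freeMap S (c.ι.app j))) :
    ∃ (k : J) (f : j ⟶ k), x.map (freeMap S (K.map f)) = y.map (freeMap S (K.map f)) := by
  induction x using Cell.induction generalizing y with
  | var v =>
    induction y using Cell.induction with
    | var w =>
      obtain ⟨k, f, e⟩ := hn.inj v w (PreCell.var.inj (congrArg Subtype.val hxy))
      exact ⟨k, f, congrArg (Cell.var (C := free S (K.obj k))) e⟩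
    | coh => cases congrArg Subtype.val hxy
  | coh B hB A hA σ ih =>
    induction y using Cell.induction with
    | var w => cases congrArg Subtype.val hxy
    | coh B' hB' A' hA' τ _ =>
      have e := congrArg Subtype.val hxy
      obtain ⟨rfl, hA, hb, hg⟩ := PreCell.coh.inj e
      obtain rfl := eq_of_heq hA
      obtain ⟨k, f, e⟩ := eventually_eq_hom h σ τ (eq_of_heq hb) fun p =>
        ih p _ (Subtype.ext (congrFun (eq_of_heq hg) p))
      exact ⟨k, f, congrArg (Cell.coh B hB A _) e⟩

end Computad

theorem PreservesFilteredColimitAt.succ {n : ℕ} {S : Stage.{u} n}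
    (h : PreservesFilteredColimitAt S c) (hn : IsFilteredColimitAt (Glob.eval (n + 1)) c) :
    PreservesFilteredColimitAt S.succ c := by
  have hcell : IsFilteredColimitAt (S.succ.Free ⋙ S.succ.Cell) c :=
    { surj := Computad.exists_lift_cell h hn
      inj := Computad.eventually_eq_cell h hn }
  refine ⟨hcell, ⟨fun x => ?_, fun {j} x y hxy => ?_⟩, fun B => ⟨fun σ => ?_, fun {j} σ τ e => ?_⟩⟩
  · let x' : (Computad.free S c.pt).Sphere := x
    obtain ⟨k, y, hy⟩ := hcell.exists_lift_of_finite (fun b : Bool => bif b then x'.fst else x'.snd)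
    let z (b : Bool) : (Computad.free S (K.obj k)).Cell := y b
    have hz (b : Bool) : (z b).map (Computad.freeMap S (c.ι.app k)) =
      bif b then x'.fst else x'.snd := hy b
    -- The two lifted cells share a boundary in the colimit, hence also at a later stage, where they
    -- form a sphere.
    obtain ⟨l, f, hf⟩ := h.sph.inj (z true).ty (z false).ty <| by
      refine (Computad.Cell.ty_map (Computad.freeMap S (c.ι.app k)) (z true)).symm.trans ?_
      refine Eq.trans ?_ (Computad.Cell.ty_map (Computad.freeMap S (c.ι.app k)) (z false))
      rw [hz, hz]
      exact x'.ty_fst.trans x'.ty_snd.symm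
    refine ⟨l, Computad.Sphere.mk (C := Computad.free S (K.obj l)) _
      ((z true).map (Computad.freeMap S (K.map f))) ((z false).map (Computad.freeMap S (K.map f)))
      rfl ?_, S.succ.sph_ext _ _ ?_ ?_⟩
    · rw [Computad.Cell.ty_map, Computad.Cell.ty_map]
      exact hf.symm
    · change ((z true).map _).map (Computad.freeMap S (c.ι.app l)) = x'.fst
      rw [← Computad.Cell.map_freeMap_comp, c.w, hz]
      rfl
    · change ((z false).map _).map (Computad.freeMap S (c.ι.app l)) = x'.snd
      rw [← Computad.Cell.map_freeMap_comp, c.w, hz]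
      rfl
  · let x' : (Computad.free S (K.obj j)).Sphere := x
    let y' : (Computad.free S (K.obj j)).Sphere := y
    obtain ⟨k, f, hf⟩ := hcell.eventually_eq_of_finite
      (fun b : Bool => bif b then x'.fst else x'.snd)
      (fun b : Bool => bif b then y'.fst else y'.snd)
      (fun b => by
        cases b
        · exact congrArg Computad.Sphere.snd hxy
        · exact congrArg Computad.Sphere.fst hxy)
    exact ⟨k, f, S.succ.sph_ext _ _ (hf true) (hf false)⟩
  · exact Computad.exists_lift_hom h σ fun p => Computad.exists_lift_cell h hn _
  · exact Computad.eventually_eq_hom h σ τ (congrArg Computad.Hom.base e) fun p =>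
      Computad.eventually_eq_cell h hn _ _ (congrFun (congrArg Computad.Hom.onGen e) p)

end Stage

theorem preservesFilteredColimitAt_stage {J : Type u} [Category.{u} J] [IsFiltered J]
    {K : J ⥤ Glob.{u}} {c : Cocone K} (hc : IsColimit c) :
    ∀ n, (stage.{u} n).PreservesFilteredColimitAt c
  | 0 => Stage.preservesFilteredColimitAt_zero
      (isFilteredColimitAt_of_isColimit _ (isColimitOfPreserves (Glob.eval 0) hc))
  | n + 1 => (preservesFilteredColimitAt_stage hc n).succ
      (isFilteredColimitAt_of_isColimit _ (isColimitOfPreserves (Glob.eval (n + 1)) hc))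

/-- The `n`-cells of the monad at `X` are by definition the cells of the free `n`-computad on `X`,
so the claim is checked one dimension at a time. -/
instance preservesFilteredColimits_fcw :
    PreservesFilteredColimitsOfSize.{u, u} fcw.{u}.toFunctor where
  preserves_filtered_colimits _ _ _ :=
    { preservesColimit := fun {_} =>
        { preserves := fun hc => ⟨Glob.isColimitOfEval _ fun n =>
            (preservesFilteredColimitAt_stage hc n).cell.isColimit⟩ } }

/-! ### Cocompleteness of the algebras of a finitary monad on globular sets -/

namespace Glob

/-- Globular sets whose cells are elements of a fixed type. -/
structure Small (W : Type u) : Type u where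
  cell : ℕ → Set W
  src : ∀ {n : ℕ}, cell (n + 1) → cell n
  tgt : ∀ {n : ℕ}, cell (n + 1) → cell n
  src_src : ∀ {n : ℕ} (x : cell (n + 2)), src (src x) = src (tgt x)
  tgt_src : ∀ {n : ℕ} (x : cell (n + 2)), tgt (src x) = tgt (tgt x)

/-- The globular set underlying a `Glob.Small`. -/
def Small.toGlob {W : Type u} (G : Small W) : Glob.{u} where
  cell n := G.cell n
  src := G.src
  tgt := G.tgt
  src_src := G.src_src
  tgt_src := G.tgt_src

/-- A globular subset whose cells embed in `W` is isomorphic to a `Glob.Small W`. -/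
theorem exists_small_of_injective {W : Type u} (Z : Glob.{u}) (P : ∀ n, Set (Z.cell n))
    (hs : ∀ {n} (x : Z.cell (n + 1)), x ∈ P (n + 1) → Z.src x ∈ P n)
    (ht : ∀ {n} (x : Z.cell (n + 1)), x ∈ P (n + 1) → Z.tgt x ∈ P n)
    (code : ∀ n, P n → W) (hcode : ∀ n, Function.Injective (code n)) :
    ∃ (G : Small W) (m : G.toGlob ⟶ Z), (∀ n, Function.Injective (m.app n)) ∧
      ∀ n, Set.range (m.app n) = P n := by
  let e (n : ℕ) : P n ≃ Set.range (code n) := Equiv.ofInjective _ (hcode n)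
  let G : Small W :=
    { cell := fun n => Set.range (code n)
      src := fun {n} w => e n ⟨_, hs _ ((e (n + 1)).symm w).2⟩
      tgt := fun {n} w => e n ⟨_, ht _ ((e (n + 1)).symm w).2⟩
      src_src := fun w => by simp only [Equiv.symm_apply_apply, Z.src_src]
      tgt_src := fun w => by simp only [Equiv.symm_apply_apply, Z.tgt_src] }
  let m : G.toGlob ⟶ Z :=
    { app := fun n w => ((e n).symm w).1
      src_app := fun {n} w => (congrArg Subtype.val
        ((e n).symm_apply_apply ⟨_, hs _ ((e (n + 1)).symm w).2⟩)).symm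
      tgt_app := fun {n} w => (congrArg Subtype.val
        ((e n).symm_apply_apply ⟨_, ht _ ((e (n + 1)).symm w).2⟩)).symm }
  refine ⟨G, m, fun n => Subtype.val_injective.comp (e n).symm.injective, fun n => ?_⟩
  ext y
  refine ⟨?_, fun hy => ⟨e n ⟨y, hy⟩, congrArg Subtype.val ((e n).symm_apply_apply _)⟩⟩
  rintro ⟨w, rfl⟩
  exact ((e n).symm w).2

theorem exists_lift_of_injective {Y Z V : Glob.{u}} (m : Y ⟶ Z)
    (hm : ∀ n, Function.Injective (m.app n)) (f : V ⟶ Z)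
    (hf : ∀ n v, f.app n v ∈ Set.range (m.app n)) : ∃ f' : V ⟶ Y, f' ≫ m = f := by
  choose g hg using hf
  refine ⟨⟨g, fun {n} x => hm n ?_, fun {n} x => hm n ?_⟩, hom_ext hg⟩
  · rw [← m.src_app, hg, hg, f.src_app]
  · rw [← m.tgt_app, hg, hg, f.tgt_app]

theorem mono_of_injective {Y Z : Glob.{u}} (m : Y ⟶ Z)
    (hm : ∀ n, Function.Injective (m.app n)) : Mono m :=
  ⟨fun _ _ h => hom_ext fun n x => hm n (congrArg (fun k => Hom.app k n x) h)⟩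

end Glob

-- Subalgebras generated by a family of morphisms, encoded by formal terms.

section Algebra

variable (T : Monad Glob.{u})

/-- Algebras whose cells are elements of a fixed type. -/
structure SmallAlgebra (W : Type u) : Type u where
  glob : Glob.Small W
  a : T.obj glob.toGlob ⟶ glob.toGlob
  unit : T.η.app glob.toGlob ≫ a = 𝟙 _
  assoc : T.μ.app glob.toGlob ≫ a = T.map a ≫ a

/-- The algebra underlying a `SmallAlgebra`. -/
def SmallAlgebra.toAlgebra {T : Monad Glob.{u}} {W : Type u} (B : SmallAlgebra T W) :
    T.Algebra where
  A := B.glob.toGlob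
  a := B.a
  unit := B.unit
  assoc := B.assoc

/-- Formal terms in variables from the globular sets `X j`, whose operations are the cells of the
globular sets `T (s i)`. -/
inductive Term {ι : Type u} (s : ι → Glob.{u}) {J : Type u} (X : J → Glob.{u}) : Type u where
  | gen (j : J) (n : ℕ) (x : (X j).cell n) : Term s X
  -- No compatibility with sources and targets is asked of `τ`; it is imposed by `Eval`. This keeps
  -- the type of terms independent of the algebra in which they are evaluated.
  | op (i : ι) (n : ℕ) (c : (T.obj (s i)).cell n) (τ : (Σ m, (s i).cell m) → Term s X) : Term s X

variable {T}

/-- `Term.Eval g t n y` means that the value of the formal term `t` in the algebra `A` is defined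
and is the `n`-cell `y`. -/
inductive Term.Eval {ι : Type u} {s : ι → Glob.{u}} {J : Type u} {X : J → Glob.{u}}
    {A : T.Algebra} (g : ∀ j, X j ⟶ A.A) : Term T s X → ∀ n, A.A.cell n → Prop where
  | gen (j : J) (n : ℕ) (x : (X j).cell n) : Eval g (.gen j n x) n ((g j).app n x)
  | op (i : ι) (n : ℕ) (c : (T.obj (s i)).cell n) (τ : (Σ m, (s i).cell m) → Term T s X)
      (f : s i ⟶ A.A) (hf : ∀ m z, Eval g (τ ⟨m, z⟩) m (f.app m z)) :
      Eval g (.op i n c τ) n (A.a.app n ((T.map f).app n c))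

namespace Term

variable {ι : Type u} {s : ι → Glob.{u}} {J : Type u} {X : J → Glob.{u}}
    {A : T.Algebra} {g : ∀ j, X j ⟶ A.A}

/-- A term and a dimension determine the value, so naming each cell by a term is injective; this
bounds the size of the subalgebra. -/
theorem Eval.unique {t : Term T s X} {n : ℕ} {y z : A.A.cell n}
    (hy : Eval g t n y) (hz : Eval g t n z) : y = z := by
  induction hy with
  | gen j n x => cases hz; rfl
  | op i n c τ f hf ih =>
    cases hz with
    | op _ _ _ _ f' hf' =>
      obtain rfl : f = f' := Glob.hom_ext fun m z => ih m z (hf' m z)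
      rfl

/-- The structure map and `T.map f` commute with sources, so only the operation `c` has to be
replaced by its source. -/
theorem Eval.exists_src {t : Term T s X} {n : ℕ} {y : A.A.cell (n + 1)}
    (h : Eval g t (n + 1) y) : ∃ t' : Term T s X, Eval g t' n (A.A.src y) := by
  cases h with
  | gen j _ x => exact ⟨.gen j n ((X j).src x), (g j).src_app x ▸ .gen j n _⟩
  | op i _ c τ f hf =>
    refine ⟨.op i n ((T.obj (s i)).src c) τ, ?_⟩
    rw [A.a.src_app, (T.map f).src_app]
    exact .op i n _ τ f hf

theorem Eval.exists_tgt {t : Term T s X} {n : ℕ} {y : A.A.cell (n + 1)}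
    (h : Eval g t (n + 1) y) : ∃ t' : Term T s X, Eval g t' n (A.A.tgt y) := by
  cases h with
  | gen j _ x => exact ⟨.gen j n ((X j).tgt x), (g j).tgt_app x ▸ .gen j n _⟩
  | op i _ c τ f hf =>
    refine ⟨.op i n ((T.obj (s i)).tgt c) τ, ?_⟩
    rw [A.a.tgt_app, (T.map f).tgt_app]
    exact .op i n _ τ f hf

end Term

/-- Every family of morphisms from the globular sets `X j` to an algebra takes values in a
subalgebra whose cells are values of formal terms. -/
theorem exists_smallAlgebra {ι : Type u} (s : ι → Glob.{u})
    (hs : ∀ (Y : Glob.{u}) (n : ℕ) (c : (T.obj Y).cell n),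
      ∃ (i : ι) (f : s i ⟶ Y) (c' : (T.obj (s i)).cell n), (T.map f).app n c' = c)
    {J : Type u} {X : J → Glob.{u}} {A : T.Algebra} (g : ∀ j, X j ⟶ A.A) :
    ∃ (B : SmallAlgebra T (Term T s X)) (m : B.toAlgebra ⟶ A), Mono m.f ∧
      ∀ j, ∃ g' : X j ⟶ B.toAlgebra.A, g' ≫ m.f = g j := by
  have hcode (n : ℕ) (y : {y : A.A.cell n | ∃ t : Term T s X, t.Eval g n y}) :
    ∃ t : Term T s X, t.Eval g n y.1 := y.2
  choose code hcode using hcode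
  obtain ⟨G, m, hm, hr⟩ := Glob.exists_small_of_injective A.A
    (fun n => {y | ∃ t : Term T s X, t.Eval g n y}) (fun _ ⟨_, h⟩ => h.exists_src)
    (fun _ ⟨_, h⟩ => h.exists_tgt) code
    (fun n y z h => Subtype.ext ((hcode n y).unique (h ▸ hcode n z)))
  have := Glob.mono_of_injective m hm
  -- The values of terms are closed under the structure map: a cell of `T` applied to the subobject
  -- comes from a shape `s i`, and terms naming the images of the cells of `s i` assemble into an
  -- `op` term.
  obtain ⟨a, ha⟩ := Glob.exists_lift_of_injective m hm (T.map m ≫ A.a) fun n c => by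
    obtain ⟨i, f, c, rfl⟩ := hs _ n c
    rw [hr]
    have hf (z : Σ k, (s i).cell k) :
        ∃ t : Term T s X, t.Eval g z.1 ((f ≫ m).app z.1 z.2) :=
      (Set.ext_iff.1 (hr z.1) _).1 ⟨_, rfl⟩
    choose τ hτ using hf
    refine ⟨.op i n c τ, ?_⟩
    have := Term.Eval.op i n c τ (f ≫ m) fun k z => hτ ⟨k, z⟩
    rwa [T.map_comp] at this
  let B : SmallAlgebra T (Term T s X) :=
    { glob := G
      a := a
      unit := by
        -- The algebra laws are inherited from `A` by cancelling the monomorphism `m`.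
        rw [← cancel_mono m, Category.assoc, ha, Category.id_comp]
        refine (T.η.naturality_assoc m A.a).symm.trans ?_
        exact (congrArg (m ≫ ·) A.unit).trans (Category.comp_id m)
      assoc := by
        rw [← cancel_mono m, Category.assoc, ha, Category.assoc, ha, ← T.map_comp_assoc, ha,
          T.map_comp_assoc]
        refine (T.μ.naturality_assoc m A.a).symm.trans ?_
        rw [A.assoc]
        rfl }
  refine ⟨B, { f := m, h := ha.symm }, this, fun j => ?_⟩
  refine Glob.exists_lift_of_injective m hm (g j) fun n x => ?_
  rw [hr]
  exact ⟨_, .gen j n x⟩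

/-- The property passes from the disks through the free-forgetful adjunction, because the forgetful
functor is faithful, preserves monomorphisms and reflects isomorphisms. -/
theorem isStrongGenerator_free_disk :
    (ObjectProperty.ofObj fun n => T.free.obj (Glob.disk.{u} n)).IsStrongGenerator := by
  rw [ObjectProperty.isStrongGenerator_iff]
  refine ⟨fun A B f g h => T.forget.map_injective ?_, fun A B f _ h => ?_⟩
  · refine Glob.isStrongGenerator_disk.isSeparating _ _ ?_
    rintro _ ⟨n⟩ x
    have := h _ (ObjectProperty.ofObj_apply _ n) ((T.adj.homEquiv _ _).symm x)
    rwa [← T.adj.homEquiv_naturality_right_symm, ← T.adj.homEquiv_naturality_right_symm,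
      (T.adj.homEquiv _ _).symm.injective.eq_iff] at this
  · have : IsIso (T.forget.map f) := by
      refine Glob.isStrongGenerator_disk.isIso_of_mono _ ?_
      rintro _ ⟨n⟩ y
      obtain ⟨x, hx⟩ := h _ (ObjectProperty.ofObj_apply _ n) ((T.adj.homEquiv _ _).symm y)
      refine ⟨T.adj.homEquiv _ _ x, ?_⟩
      change T.adj.homEquiv _ _ x ≫ T.forget.map f = y
      rw [← T.adj.homEquiv_naturality_right]
      exact (congrArg _ hx).trans (Equiv.apply_symm_apply _ _)
    exact isIso_of_reflects_iso f T.forget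

-- Algebras of a finitary monad: colimits and presentability.

open Cardinal

attribute [local instance] fact_isRegular_aleph0

variable [PreservesFilteredColimitsOfSize.{u, u} T.toFunctor]

variable (T) in
-- Every globular set is a filtered colimit of objects from one small family, and `T` preserves that
-- colimit, so each cell of `T.obj Y` comes from a member of the family.
theorem exists_small_shapes : ∃ (ι : Type u) (s : ι → Glob.{u}),
    ∀ (Y : Glob.{u}) (n : ℕ) (c : (T.obj Y).cell n),
      ∃ (i : ι) (f : s i ⟶ Y) (c' : (T.obj (s i)).cell n), (T.map f).app n c' = c := by
  obtain ⟨P, _, hP⟩ := HasCardinalFilteredGenerator.exists_small_generator Glob.{u} (ℵ₀ : Cardinal.{u})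
  refine ⟨Shrink.{u} (Subtype P), fun i => ((equivShrink _).symm i).1, fun Y n c => ?_⟩
  obtain ⟨J, _, _, ⟨p⟩⟩ := hP.exists_colimitsOfShape Y
  have : IsFiltered J := (isCardinalFiltered_aleph0_iff J).1 inferInstance
  obtain ⟨j, (c' : (T.obj (p.diag.obj j)).cell n), hc'⟩ := Types.jointly_surjective_of_isColimit
    (isColimitOfPreserves (T.toFunctor ⋙ Glob.eval n) p.isColimit) c
  obtain ⟨i, hi⟩ := (equivShrink (Subtype P)).symm.surjective ⟨_, p.prop_diag_obj j⟩
  have e : ((equivShrink (Subtype P)).symm i).1 = p.diag.obj j := congrArg Subtype.val hi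
  refine ⟨i, eqToHom e ≫ p.ι.app j, (T.map (eqToHom e.symm)).app n c', ?_⟩
  have : T.map (eqToHom e.symm) ≫ T.map (eqToHom e ≫ p.ι.app j) = T.map (p.ι.app j) := by
    rw [← T.map_comp]
    simp
  exact (congrArg (fun k => Glob.Hom.app k n c') this).trans hc'

/-- Colimits of shape `J` amount to a left adjoint of the constant-diagram functor, which preserves
limits; algebras have limits, created by the forgetful functor, so a solution set is enough. -/
instance hasColimits_algebra : HasColimitsOfSize.{u, u} T.Algebra where
  has_colimits_of_shape J _ := by
    rw [hasColimitsOfShape_iff_isRightAdjoint_const]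
    have : HasLimitsOfSize.{u, u} T.Algebra :=
      hasLimits_of_hasLimits_createsLimits T.forget
    apply isRightAdjoint_of_preservesLimits_of_solutionSetCondition
    intro D
    obtain ⟨ι, s, hs⟩ := exists_small_shapes T
    -- The solution set consists of the cocones whose vertex has its cells in the type of terms on
    -- the diagram; this is a type in universe `u`.
    refine ⟨Σ B : SmallAlgebra T (Term T s fun j => (D.obj j).A),
      D ⟶ (Functor.const J).obj B.toAlgebra, fun i => i.1.toAlgebra, fun i => i.2,
      fun A h => ?_⟩
    obtain ⟨B, m, _, hB⟩ := exists_smallAlgebra s hs fun j => (h.app j).f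
    choose g hg using hB
    have : Mono m := T.forget.mono_of_mono_map ‹_›
    -- The factored legs are algebra morphisms because they become so after composition with the
    -- monomorphism `m`.
    have hm (j : J) : T.map (g j) ≫ B.toAlgebra.a = (D.obj j).a ≫ g j := by
      rw [← cancel_mono m.f, Category.assoc, Category.assoc, hg, ← m.h, ← T.map_comp_assoc, hg]
      exact (h.app j).h
    let k (j : J) : D.obj j ⟶ B.toAlgebra := { f := g j, h := hm j }
    have hk (j : J) : k j ≫ m = h.app j := Monad.Algebra.Hom.ext (hg j)
    refine ⟨⟨B, { app := k, naturality := fun i j f => ?_ }⟩, m, ?_⟩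
    · rw [← cancel_mono m, Category.assoc, hk]
      refine (h.naturality f).trans ?_
      simp [hk]
    · ext j : 2
      exact hk j

/-- Since `T` preserves filtered colimits, the forgetful functor creates them, and hence preserves
them. -/
instance isFinitelyAccessible_forget : T.forget.IsCardinalAccessible (ℵ₀ : Cardinal.{u}) where
  preservesColimitOfShape J _ _ := by
    have : IsFiltered J := (isCardinalFiltered_aleph0_iff J).1 inferInstance
    have : PreservesColimitsOfShape J T.toFunctor := inferInstance
    exact preservesColimitOfShape_of_createsColimitsOfShape_and_hasColimitsOfShape T.forget

/-- The algebras of a finitary monad on globular sets form a locally finitely presentable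
category. -/
theorem isLocallyFinitelyPresentable_algebra : IsLocallyFinitelyPresentable.{u} T.Algebra := by
  refine (IsCardinalLocallyPresentable.iff_exists_isStrongGenerator _ _).2 ⟨_, inferInstance, isStrongGenerator_free_disk, ?_⟩
  rintro _ ⟨n⟩
  rw [isCardinalPresentable_iff]
  -- A left adjoint preserves presentable objects when its right adjoint is accessible.
  exact T.adj.isCardinalPresentable_leftAdjoint_obj ℵ₀ _

end Algebra

end WeakOmega

theorem mainTheorem10 :
    Limits.PreservesFilteredColimitsOfSize.{u, u} WeakOmega.fcw.{u}.toFunctor ∧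
      IsLocallyFinitelyPresentable.{u} WeakOmega.OmegaCat.{u} :=
  ⟨WeakOmega.preservesFilteredColimits_fcw,
    WeakOmega.isLocallyFinitelyPresentable_algebra⟩
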